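/- Let $k$ be a field and let $\mathrm{OI}$ be the category with objects $[n]=\{1,\dots,n\}$ ($n\ge 0$) and order-preserving injections as morphisms. An $\mathrm{OI}$-algebra over $k$ is a functor $\mathbf A$ from $\mathrm{OI}$ to commutative $k$-algebras; an $\mathbf A$-module is a functor $\mathbf M$ from $\mathrm{OI}$ to $k$-modules together with an $\mathbf A(w)$-module structure on each $\mathbf M(w)$ such that $\varepsilon_*(ax)=\varepsilon_*(a)\,\varepsilon_*(x)$ for all $\varepsilon\colon [w]\to[w']$, $a\in\mathbf A(w)$, $x\in\mathbf M(w)$. It is finitely generated if some finite set of elements lies in no proper submodule. Graded algebras and modules are $\mathbb Z$-graded in each width, with structure maps preserving degrees; morphisms of graded modules preserve degrees. Let $\mathbf F^{\mathrm{OI},n}$ be the $\mathrm{OI}$-module for which $\mathbf F^{\mathrm{OI},n}(w)$ is the free $k$-module with basis $\{e_\pi : \pi\in\mathrm{Hom}_{\mathrm{OI}}([n],[w])\}$ and $\varepsilon_*(e_\pi)=e_{\varepsilon\circ\pi}$. A (graded) polynomial $\mathrm{OI}$-algebra is one isomorphic, as a graded $\mathrm{OI}$-algebra, to $\mathrm{Sym}_\bullet\bigl(\bigoplus_{i=1}^r\mathbf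 F^{\mathrm{OI},n_i}\bigr)$, where the generator $e_{\mathrm{id}}$ of the $i$-th summand has a positive degree $d_i\ge 1$ (standard-graded if all $d_i=1$). It is noetherian if each of its ideals ($\mathbf A$-submodules of $\mathbf A$) is finitely generated. A finitely generated graded free $\mathbf A$-module is a graded module $\mathbf F$ having a finite homogeneous basis: homogeneous elements $f_1,\dots,f_s$, $f_i\in\mathbf F(u_i)$, such that for every $w$ the elements $\varepsilon_*(f_i)$, $1\le i\le s$, $\varepsilon\in\mathrm{Hom}([u_i],[w])$, form a basis of the $\mathbf A(w)$-module $\mathbf F(w)$ (equivalently, $\mathbf F$ is isomorphic to a finite direct sum of degree shifts of modules $\mathbf A\otimes_k\mathbf F^{\mathrm{OI},u}$). A graded map $\varphi\colon\mathbf F\to\mathbf G$ of such modules is minimal if for all homogeneous bases $f_i$ of $\mathbf F$ (of widths $u_i$) and $g_j$ of $\mathbf G$ (of widths $v_j$), when one writes $$\varphi(f_i)=\sum_j\sum_{\varepsilon\in\mathrm{Hom}([v_j],[u_i])}a_{i,j,\varepsilon}\,\varepsilon_*(g_j),\qquad a_{i,j,\varepsilon}\in\mathbf A(u_i),$$ no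 coefficient $a_{i,j,\varepsilon}$ for which $\varepsilon$ is an identity morphism is a unit. A graded resolution of $\mathbf M$ by finitely generated free modules is an exact sequence $\cdots\to\mathbf F_2\to\mathbf F_1\to\mathbf F_0\to\mathbf M\to 0$ of graded $\mathbf A$-modules with all $\mathbf F_i$ finitely generated graded free; it is a graded minimal free resolution if all the maps $\mathbf F_{i+1}\to\mathbf F_i$, $i\ge 0$, are minimal. A map of resolutions of $\mathbf M$ is a graded chain map inducing the identity on $\mathbf M$. **Theorem.** Let $\mathbf A$ be a polynomial $\mathrm{OI}$-algebra over a field $k$, graded as above, and let $\mathbf M$ be a finitely generated graded $\mathbf A$-module. (i) Every graded resolution $\mathbf F_\bullet$ of $\mathbf M$ by finitely generated free $\mathbf A$-modules contains a graded minimal free resolution $\mathbf P_\bullet$ of $\mathbf M$ as a direct summand, i.e. there are maps of resolutions $s\colon\mathbf P_\bullet\to\mathbf F_\bullet$ and $p\colon\mathbf F_\bullet\to\mathbf P_\bullet$ with $p\circ s=\mathrm{id}$. (ii) Any two graded minimal free resolutions of $\mathbf M$ are isomorphic (by mutually inverse maps of resolutions). (iii) If $\mathbf A$ is noetherian, then $\mathbf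 M$ has a graded minimal free resolution. -/

import Mathlib

universe u

/-- Morphisms `m ⟶ n` in (the skeleton of) the category `OI`: order-preserving injections
`[m] → [n]`. The composite `δ ∘ ε` is `ε.trans δ` and the identity is `RelEmbedding.refl _`. -/
abbrev OIHom (m n : ℕ) : Type := Fin m ↪o Fin n

/-- A commutative `OI`-algebra over `k`: a functor from `OI` to commutative `k`-algebras. -/
structure OIAlgebra (k : Type u) [CommRing k] where
  obj : ℕ → Type u
  [commRing : ∀ w, CommRing (obj w)]
  [algebra : ∀ w, Algebra k (obj w)]
  map : ∀ {m n : ℕ}, OIHom m n → (obj m →ₐ[k] obj n)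
  map_id : ∀ (w : ℕ) (a : obj w), map (RelEmbedding.refl _ : OIHom w w) a = a
  map_comp : ∀ {l m n : ℕ} (ε : OIHom l m) (δ : OIHom m n) (a : obj l),
    map (ε.trans δ : OIHom l n) a = map δ (map ε a)

attribute [instance] OIAlgebra.commRing OIAlgebra.algebra

/-- A module over an `OI`-algebra `A`: a functor `M` on `OI` such that every `M(w)` is an
`A(w)`-module and the structure maps are compatible with those of `A`. (The `k`-module structure
on `M(w)` is the one induced by `k → A(w)`, and `map_smul` makes the structure maps `k`-linear.) -/
structure OIModule {k : Type u} [CommRing k] (A : OIAlgebra k) where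
  obj : ℕ → Type u
  [addCommGroup : ∀ w, AddCommGroup (obj w)]
  [module : ∀ w, Module (A.obj w) (obj w)]
  map : ∀ {m n : ℕ}, OIHom m n → (obj m →+ obj n)
  map_id : ∀ (w : ℕ) (x : obj w), map (RelEmbedding.refl _ : OIHom w w) x = x
  map_comp : ∀ {l m n : ℕ} (ε : OIHom l m) (δ : OIHom m n) (x : obj l),
    map (ε.trans δ : OIHom l n) x = map δ (map ε x)
  map_smul : ∀ {m n : ℕ} (ε : OIHom m n) (a : A.obj m) (x : obj m),
    map ε (a • x) = A.map ε a • map ε x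

attribute [instance] OIModule.addCommGroup OIModule.module

/-- An `A`-submodule: a subfunctor which in every width `w` is an `A(w)`-submodule. -/
structure OISubmodule {k : Type u} [CommRing k] {A : OIAlgebra k} (M : OIModule A) where
  carrier : ∀ w, Submodule (A.obj w) (M.obj w)
  map_mem : ∀ {m n : ℕ} (ε : OIHom m n) (x : M.obj m), x ∈ carrier m → M.map ε x ∈ carrier n

/-- `G` is a generating set of `N`: `N` is the smallest submodule containing the
elements of `G`. -/
def OISubmodule.IsGeneratedBy {k : Type u} [CommRing k] {A : OIAlgebra k} {M : OIModule A}
    (N : OISubmodule M) (G : Set (Σ w, M.obj w)) : Prop :=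
  (∀ g ∈ G, g.2 ∈ N.carrier g.1) ∧
    ∀ N' : OISubmodule M, (∀ g ∈ G, g.2 ∈ N'.carrier g.1) → ∀ w, N.carrier w ≤ N'.carrier w

/-- A finitely generated submodule. -/
def OISubmodule.FG {k : Type u} [CommRing k] {A : OIAlgebra k} {M : OIModule A}
    (N : OISubmodule M) : Prop :=
  ∃ G : Set (Σ w, M.obj w), G.Finite ∧ N.IsGeneratedBy G

/-- The whole module as a submodule of itself. -/
def OIModule.top {k : Type u} [CommRing k] {A : OIAlgebra k} (M : OIModule A) :
    OISubmodule M where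
  carrier := fun _ => ⊤
  map_mem := fun _ _ _ => Submodule.mem_top

/-- A finitely generated `A`-module. -/
def OIModule.FG {k : Type u} [CommRing k] {A : OIAlgebra k} (M : OIModule A) : Prop :=
  M.top.FG

/-- `A` as a module over itself. -/
def OIAlgebra.self {k : Type u} [CommRing k] (A : OIAlgebra k) : OIModule A where
  obj := A.obj
  map := fun ε => (A.map ε : _ →+ _)
  map_id := A.map_id
  map_comp := A.map_comp
  map_smul := fun ε a x => _root_.map_mul (A.map ε) a x

/-- `A` is noetherian: every ideal (`A`-submodule of `A`) is finitely generated. -/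
def OIAlgebra.IsNoetherian {k : Type u} [CommRing k] (A : OIAlgebra k) : Prop :=
  ∀ I : OISubmodule A.self, I.FG

/-- A (`ℤ`-)graded commutative `OI`-algebra: every `A(w)` is a graded `k`-algebra and the
structure maps preserve degrees. -/
structure GradedOIAlgebra (k : Type u) [CommRing k] extends OIAlgebra k where
  gr : ∀ w, ℤ → Submodule k (obj w)
  gradedMonoid : ∀ w, SetLike.GradedMonoid (gr w)
  isInternal : ∀ w, DirectSum.IsInternal (gr w)
  map_mem_gr : ∀ {m n : ℕ} (ε : OIHom m n) (d : ℤ) (a : obj m), a ∈ gr m d → map ε a ∈ gr n d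

/-- A (`ℤ`-)graded module over a graded `OI`-algebra. -/
structure GradedOIModule {k : Type u} [CommRing k] (A : GradedOIAlgebra k) extends
    OIModule A.toOIAlgebra where
  gr : ∀ w, ℤ → AddSubgroup (obj w)
  smul_mem_gr : ∀ (w : ℕ) (c d : ℤ) (a : A.obj w) (x : obj w),
    a ∈ A.gr w c → x ∈ gr w d → a • x ∈ gr w (c + d)
  isInternal : ∀ w, DirectSum.IsInternal (gr w)
  map_mem_gr : ∀ {m n : ℕ} (ε : OIHom m n) (d : ℤ) (x : obj m), x ∈ gr m d → map ε x ∈ gr n d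

/-- An isomorphism of graded `OI`-algebras. -/
structure GradedOIAlgebra.Iso {k : Type u} [CommRing k] (A B : GradedOIAlgebra k) where
  equiv : ∀ w, A.obj w ≃ₐ[k] B.obj w
  naturality : ∀ {m n : ℕ} (ε : OIHom m n) (a : A.obj m),
    equiv n (A.map ε a) = B.map ε (equiv m a)
  mem_gr_iff : ∀ (w : ℕ) (d : ℤ) (a : A.obj w), equiv w a ∈ B.gr w d ↔ a ∈ A.gr w d

/-- The standard basis in width `w` of the free `OI`-module `⊕ᵢ F^{OI, nᵢ}`, namely the set
`{e_π : π ∈ Hom(nᵢ, w), 1 ≤ i ≤ r}`. -/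
abbrev OIIndex {r : ℕ} (n : Fin r → ℕ) (w : ℕ) : Type := Σ i : Fin r, OIHom (n i) w

/-- The action `e_π ↦ e_{ε ∘ π}` of a morphism `ε` on standard basis elements. -/
def OIIndex.push {r : ℕ} {n : Fin r → ℕ} {w w' : ℕ} (ε : OIHom w w') (v : OIIndex n w) :
    OIIndex n w' :=
  ⟨v.1, v.2.trans ε⟩

/-- Renaming variables compatibly with their weights preserves weighted homogeneity. -/
theorem OIIndex.rename_isWeightedHomogeneous {k : Type u} [CommRing k] {r : ℕ} {n : Fin r → ℕ}
    (deg : Fin r → ℤ) {w w' : ℕ} (ε : OIHom w w') (d : ℤ) (p : MvPolynomial (OIIndex n w) k)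
    (hp : MvPolynomial.IsWeightedHomogeneous (fun v : OIIndex n w => deg v.1) p d) :
    MvPolynomial.IsWeightedHomogeneous (fun v : OIIndex n w' => deg v.1)
      (MvPolynomial.rename (OIIndex.push ε) p) d := by
  intro m hm
  obtain ⟨x, rfl, hx⟩ := MvPolynomial.coeff_rename_ne_zero _ _ _ hm
  rw [← hp hx, Finsupp.weight_apply, Finsupp.weight_apply, Finsupp.sum_mapDomain_index]
  · rfl
  · intro; simp
  · intro; simp [add_mul]

/-- The graded `OI`-algebra `Sym(⊕ᵢ F^{OI, nᵢ})`, with the generator of the `i`-th summand in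
degree `deg i`. In width `w` it is the symmetric algebra of the free `k`-module with basis
`OIIndex n w`, i.e. the polynomial ring with these variables (`IsSymmetricAlgebra.mvPolynomial`). -/
noncomputable def symOIAlgebra (k : Type u) [CommRing k] {r : ℕ} (n : Fin r → ℕ)
    (deg : Fin r → ℤ) : GradedOIAlgebra k where
  obj := fun w => MvPolynomial (OIIndex n w) k
  map := fun ε => MvPolynomial.rename (OIIndex.push ε)
  map_id := fun _ a => MvPolynomial.rename_id_apply a
  map_comp := fun ε δ a =>
    (MvPolynomial.rename_rename (OIIndex.push ε) (OIIndex.push δ) a).symm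
  gr := fun w d =>
    MvPolynomial.weightedHomogeneousSubmodule k (fun v : OIIndex n w => deg v.1) d
  gradedMonoid := fun _ => MvPolynomial.weightedGradedAlgebra k _ |>.toGradedMonoid
  isInternal := fun w =>
    (MvPolynomial.weightedGradedAlgebra k
      (fun v : OIIndex n w => deg v.1)).toDecomposition.isInternal
  map_mem_gr := fun ε d a ha => OIIndex.rename_isWeightedHomogeneous deg ε d a ha

/-- `A` is a (positively) graded polynomial `OI`-algebra: it is isomorphic to `Sym(F)` for a
finitely generated graded free `OI`-module `F` over `k` generated in positive degrees. -/
def GradedOIAlgebra.IsPolynomial {k : Type u} [CommRing k] (A : GradedOIAlgebra k) : Prop :=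
  ∃ (r : ℕ) (n : Fin r → ℕ) (deg : Fin r → ℤ), (∀ i, 0 < deg i) ∧
    Nonempty (A.Iso (symOIAlgebra k n deg))

/-- A degree-preserving morphism of graded `A`-modules. -/
structure GradedOIModule.Hom {k : Type u} [CommRing k] {A : GradedOIAlgebra k}
    (M N : GradedOIModule A) where
  app : ∀ w, M.obj w →ₗ[A.obj w] N.obj w
  naturality : ∀ {m n : ℕ} (ε : OIHom m n) (x : M.obj m), app n (M.map ε x) = N.map ε (app m x)
  app_mem_gr : ∀ (w : ℕ) (d : ℤ) (x : M.obj w), x ∈ M.gr w d → app w x ∈ N.gr w d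

/-- A finite homogeneous basis `f₁, …, f_r` of a graded `A`-module `F`, where `fᵢ` has width
`width i` and degree `deg i`: in every width `w` the family `ε(fᵢ)`, with
`ε ∈ Hom(width i, w)`, is a basis of the `A(w)`-module `F(w)`. Equivalently, it is an isomorphism
of `F` with the direct sum of the free modules `A ⊗ F^{OI, width i}`, with `e_id` of the `i`-th
summand placed in degree `deg i`. -/
structure GradedOIModule.HomogeneousBasis {k : Type u} [CommRing k] {A : GradedOIAlgebra k}
    (F : GradedOIModule A) where
  rank : ℕ
  width : Fin rank → ℕ
  deg : Fin rank → ℤ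
  elt : ∀ i, F.obj (width i)
  elt_mem_gr : ∀ i, elt i ∈ F.gr (width i) (deg i)
  basisAt : ∀ w, Module.Basis (OIIndex width w) (A.obj w) (F.obj w)
  basisAt_apply : ∀ (w : ℕ) (v : OIIndex width w), basisAt w v = F.map v.2 (elt v.1)

/-- A finitely generated graded free `A`-module. -/
def GradedOIModule.IsFinFree {k : Type u} [CommRing k] {A : GradedOIAlgebra k}
    (F : GradedOIModule A) : Prop :=
  Nonempty F.HomogeneousBasis

/-- Minimality of a map `φ : F → G` with respect to homogeneous bases `f₁, …, f_s` of `F` and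
`g₁, …, g_t` of `G`: writing `φ(fᵢ) = ∑ⱼ ∑_ε a_{i, j, ε} • ε(gⱼ)`, no coefficient belonging to an
identity morphism `ε` (so `gⱼ` and `fᵢ` have the same width) is a unit. -/
def GradedOIModule.Hom.IsMinimalWith {k : Type u} [CommRing k] {A : GradedOIAlgebra k}
    {F G : GradedOIModule A} (φ : F.Hom G) (f : F.HomogeneousBasis) (g : G.HomogeneousBasis) :
    Prop :=
  ∀ (i : Fin f.rank) (j : Fin g.rank) (h : g.width j = f.width i),
    ¬ IsUnit ((g.basisAt (f.width i)).repr (φ.app (f.width i) (f.elt i))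
      ⟨j, (Fin.castOrderIso h).toOrderEmbedding⟩)

/-- Minimality of a map between finitely generated graded free modules (with respect to all
homogeneous bases). -/
def GradedOIModule.Hom.IsMinimal {k : Type u} [CommRing k] {A : GradedOIAlgebra k}
    {F G : GradedOIModule A} (φ : F.Hom G) : Prop :=
  ∀ (f : F.HomogeneousBasis) (g : G.HomogeneousBasis), φ.IsMinimalWith f g

/-- A graded resolution `⋯ → F₂ → F₁ → F₀ → M → 0` of `M` by finitely generated free
`A`-modules. -/
structure FreeOIResolution {k : Type u} [CommRing k] {A : GradedOIAlgebra k}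
    (M : GradedOIModule A) where
  X : ℕ → GradedOIModule A
  free : ∀ i, (X i).IsFinFree
  d : ∀ i, (X (i + 1)).Hom (X i)
  aug : (X 0).Hom M
  aug_surjective : ∀ w, Function.Surjective (aug.app w)
  exact_aug : ∀ w, Function.Exact ((d 0).app w) (aug.app w)
  exact_d : ∀ i w, Function.Exact ((d (i + 1)).app w) ((d i).app w)

/-- A graded minimal free resolution: all maps between its free modules are minimal. -/
def FreeOIResolution.IsMinimal {k : Type u} [CommRing k] {A : GradedOIAlgebra k}
    {M : GradedOIModule A} (F : FreeOIResolution M) : Prop :=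
  ∀ i, (F.d i).IsMinimal

/-- A degree-preserving map of resolutions of `M`: a chain map over the identity of `M`. -/
structure FreeOIResolution.Hom {k : Type u} [CommRing k] {A : GradedOIAlgebra k}
    {M : GradedOIModule A} (F G : FreeOIResolution M) where
  f : ∀ i, (F.X i).Hom (G.X i)
  comm : ∀ i w x, (f i).app w ((F.d i).app w x) = (G.d i).app w ((f (i + 1)).app w x)
  comm_aug : ∀ w x, G.aug.app w ((f 0).app w x) = F.aug.app w x

/-- `P` is (isomorphic to) a direct summand of `F`, as a graded resolution of `M`: there are maps
of resolutions `s : P → F` and `p : F → P` with `p ∘ s = id`, so that `F = s(P) ⊕ ker p` as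
complexes of graded `A`-modules. -/
def FreeOIResolution.IsDirectSummand {k : Type u} [CommRing k] {A : GradedOIAlgebra k}
    {M : GradedOIModule A} (P F : FreeOIResolution M) : Prop :=
  ∃ (s : P.Hom F) (p : F.Hom P), ∀ i w x, (p.f i).app w ((s.f i).app w x) = x

/-- `F` and `G` are isomorphic as graded resolutions of `M`. -/
def FreeOIResolution.IsIsomorphic {k : Type u} [CommRing k] {A : GradedOIAlgebra k}
    {M : GradedOIModule A} (F G : FreeOIResolution M) : Prop :=
  ∃ (s : F.Hom G) (t : G.Hom F), (∀ i w x, (t.f i).app w ((s.f i).app w x) = x) ∧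
    ∀ i w y, (s.f i).app w ((t.f i).app w y) = y

/-!
Minimal resolutions over a polynomial `OI`-algebra `A` behave as over a graded local ring. The part
of the maximal ideal times a free module `F` is played by the submodule `F.radical`, which in width
`w` is generated by `A₊ F(w)` and by the images of all smaller widths. A homogeneous element lies in
it exactly if no coefficient at a basis element of its own width is a unit
(`not_isUnit_repr_of_mem_radical`, `mem_radical_of_not_isUnit`), so a morphism of free modules is
minimal if and only if its image lies in the radical. Nakayama's lemma holds for the radical
(`surjective_of_sub_mem_radical`), by induction on the pairs (degree, width) of the finitely many
basis elements. As `F(w)` is a finite `A(w)`-module, surjective endomorphisms are bijective, so an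
endomorphism which is surjective modulo the radical is an automorphism. These facts only need `A`
to be non-negatively graded with a field in degree zero.

For the first part, a resolution `F` of `M` is split step by step. Suppose that `U` is a direct
summand, with inclusion `s` and projection `p`, of the target of the `n`-th map `e` of the augmented
complex, compatibly with the image of `e`. A cover `c : P → U` of the image of `p ∘ e` by a free
module of minimal rank has its kernel in the radical (`exists_minimal_cover`). Lifting maps between
`P` and `F_n` gives an endomorphism of `P` which is the identity modulo that kernel, hence an
automorphism, and dividing it out makes `P` a direct summand of `F_n`, compatibly with the kernels
of `c` and `e`. Iterating gives the minimal resolution `minimalPart` and both maps at once.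

For the second part, an endomorphism of a minimal resolution over the identity of `M` is
bijective in every degree, by induction: it reaches every element up to a boundary, and boundaries
lie in the radical. Applied to the two composites of comparison maps this shows that these are
isomorphisms.

For the third part it remains to see that kernels of maps from free modules are finitely generated
if `A` is noetherian. If some generator of `A` had width at least two, the products of variables
along "cycles" of growing length would be an infinite antichain of monomials, and the ideal
they generate would not be finitely generated (`width_le_one_of_isNoetherian`). If all widths are at
most one, the monomials of a free module are words over a well-quasi-ordered alphabet, so by
Higman's lemma they are well-quasi-ordered (`wellQuasiOrdered_exponents`), and comparing leading terms shows
that every submodule is finitely generated (`fg_of_width_le_one`).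
-/

/-! ### Homogeneous components -/

section Components

variable {V S : Type*} [AddCommGroup V] [SetLike S V] [AddSubgroupClass S V] {G : ℤ → S}

/-- The homogeneous component of degree `d`, as an endomorphism of the graded group. -/
noncomputable def DirectSum.IsInternal.component (h : DirectSum.IsInternal G) (d : ℤ) : V →+ V :=
  (AddSubmonoidClass.subtype (G d)).comp
    ((DFinsupp.evalAddMonoidHom d).comp
      (AddEquiv.ofBijective (DirectSum.coeAddMonoidHom G) h).symm.toAddMonoidHom)

namespace DirectSum.IsInternal

theorem component_mem (h : DirectSum.IsInternal G) (d : ℤ) (x : V) : h.component d x ∈ G d :=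
  SetLike.coe_mem _

theorem component_apply (h : DirectSum.IsInternal G) (e d : ℤ) {x : V} (hx : x ∈ G e) :
    h.component d x = if e = d then x else 0 := by
  have : (AddEquiv.ofBijective (DirectSum.coeAddMonoidHom G) h).symm x
      = DirectSum.of (fun i => G i) e ⟨x, hx⟩ := by
    rw [AddEquiv.symm_apply_eq]
    exact (DirectSum.coeAddMonoidHom_of G e ⟨x, hx⟩).symm
  change (((AddEquiv.ofBijective (DirectSum.coeAddMonoidHom G) h).symm x) d : V) = _
  rw [this]
  split_ifs with hed
  · subst hed
    rw [DirectSum.of_eq_same]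
  · rw [DirectSum.of_eq_of_ne _ _ _ (Ne.symm hed)]
    rfl

theorem component_of_mem (h : DirectSum.IsInternal G) {d : ℤ} {x : V} (hx : x ∈ G d) :
    h.component d x = x := by
  rw [h.component_apply d d hx, if_pos rfl]

theorem component_of_mem_ne (h : DirectSum.IsInternal G) {e d : ℤ} {x : V} (hx : x ∈ G e)
    (hed : e ≠ d) : h.component d x = 0 := by
  rw [h.component_apply e d hx, if_neg hed]

theorem homogeneous_induction (h : DirectSum.IsInternal G) {p : V → Prop}
    (hom : ∀ d, ∀ x ∈ G d, p x) (add : ∀ x y, p x → p y → p (x + y)) (x : V) : p x := by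
  obtain ⟨y, rfl⟩ := h.2 x
  induction y using DirectSum.induction_on with
  | zero => simpa using hom 0 0 (zero_mem _)
  | of i y => simpa using hom i y y.2
  | add y z hy hz => simpa using add _ _ hy hz

theorem exists_eq_sum_component (h : DirectSum.IsInternal G) (x : V) :
    ∃ s : Finset ℤ, x = ∑ d ∈ s, h.component d x := by
  classical
  suffices H : ∃ s : Finset ℤ, ∀ t, s ⊆ t → x = ∑ d ∈ t, h.component d x by
    obtain ⟨s, hs⟩ := H
    exact ⟨s, hs s subset_rfl⟩
  induction x using h.homogeneous_induction with
  | hom d x hx =>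
    refine ⟨{d}, fun t ht => ?_⟩
    simp only [h.component_apply d _ hx]
    rw [Finset.sum_ite_eq, if_pos (by simpa using ht)]
  | add x y hx hy =>
    obtain ⟨s, hs⟩ := hx
    obtain ⟨s', hs'⟩ := hy
    refine ⟨s ∪ s', fun t ht => ?_⟩
    simp only [map_add, Finset.sum_add_distrib]
    rw [← hs t (Finset.union_subset_left ht), ← hs' t (Finset.union_subset_right ht)]

/-- A family of subgroups is an internal grading as soon as it spans and there are additive
projections onto its members that kill the other members. -/
theorem of_projections {V : Type*} [AddCommGroup V] {G : ℤ → AddSubgroup V} (π : ℤ → V →+ V)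
    (hπ : ∀ d e, ∀ x ∈ G e, π d x = if e = d then x else 0) (hG : ∀ x, x ∈ ⨆ d, G d) :
    DirectSum.IsInternal G := by
  have key : ∀ (d : ℤ) (y : DirectSum ℤ fun i => G i),
      π d (DirectSum.coeAddMonoidHom G y) = (y d : V) := by
    intro d y
    induction y using DirectSum.induction_on with
    | zero => simp
    | of i y =>
      rw [DirectSum.coeAddMonoidHom_of, hπ d i y y.2]
      split_ifs with h
      · subst h
        rw [DirectSum.of_eq_same]
      · rw [DirectSum.of_eq_of_ne _ _ _ (Ne.symm h)]
        rfl
    | add y z hy hz => simp [hy, hz]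
  constructor
  · rw [injective_iff_map_eq_zero]
    intro y hy
    ext d
    rw [← key, hy, map_zero]
    rfl
  · intro x
    induction hG x using AddSubgroup.iSup_induction' with
    | hp d x hx => exact ⟨DirectSum.of (fun i => G i) d ⟨x, hx⟩, by simp⟩
    | h1 => exact ⟨0, by simp⟩
    | hadd x y _ _ hx hy =>
      obtain ⟨y, rfl⟩ := hx
      obtain ⟨z, rfl⟩ := hy
      exact ⟨y + z, by simp⟩

end DirectSum.IsInternal

end Components

section Graded

variable {k : Type u} [CommRing k] {A : GradedOIAlgebra k}

namespace GradedOIModule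

/-- The homogeneous component of degree `d`. -/
noncomputable abbrev component (F : GradedOIModule A) (w : ℕ) (d : ℤ) : F.obj w →+ F.obj w :=
  (F.isInternal w).component d

theorem Hom.app_component {F G : GradedOIModule A} (φ : F.Hom G) (w : ℕ) (d : ℤ) (x : F.obj w) :
    φ.app w (F.component w d x) = G.component w d (φ.app w x) := by
  induction x using (F.isInternal w).homogeneous_induction with
  | hom e x hx =>
    rw [(F.isInternal w).component_apply e d hx,
      (G.isInternal w).component_apply e d (φ.app_mem_gr w e x hx)]
    split_ifs <;> simp
  | add x y hx hy => simp [hx, hy]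

theorem component_smul (F : GradedOIModule A) (w : ℕ) (d e : ℤ) (a : A.obj w) {x : F.obj w}
    (hx : x ∈ F.gr w e) :
    F.component w d (a • x) = (A.isInternal w).component (d - e) a • x := by
  induction a using (A.isInternal w).homogeneous_induction with
  | hom c a ha =>
    rw [(F.isInternal w).component_apply (c + e) d (F.smul_mem_gr w c e a x ha hx),
      (A.isInternal w).component_apply c (d - e) ha]
    by_cases h : c = d - e
    · rw [if_pos h, if_pos (by lia)]
    · rw [if_neg h, if_neg (by lia), zero_smul]
  | add a b ha hb => simp [add_smul, ha, hb]

namespace HomogeneousBasis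

theorem basisAt_mem_gr {F : GradedOIModule A} (f : F.HomogeneousBasis) (w : ℕ)
    (v : OIIndex f.width w) : f.basisAt w v ∈ F.gr w (f.deg v.1) := by
  rw [f.basisAt_apply]
  exact F.map_mem_gr _ _ _ (f.elt_mem_gr _)

theorem repr_component {F : GradedOIModule A} (f : F.HomogeneousBasis) (w : ℕ) (d : ℤ)
    (x : F.obj w) (v : OIIndex f.width w) :
    (f.basisAt w).repr (F.component w d x) v
      = (A.isInternal w).component (d - f.deg v.1) ((f.basisAt w).repr x v) := by
  classical
  obtain ⟨c, rfl⟩ := (f.basisAt w).repr.symm.surjective x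
  rw [LinearEquiv.apply_symm_apply]
  induction c using Finsupp.induction_linear with
  | zero => simp
  | add x y hx hy => simp only [map_add, Finsupp.add_apply, hx, hy]
  | single v' a =>
    rw [Module.Basis.repr_symm_single, F.component_smul w d _ a (f.basisAt_mem_gr w v'), map_smul,
      Module.Basis.repr_self, Finsupp.smul_single, smul_eq_mul, mul_one]
    rcases eq_or_ne v' v with rfl | h
    · simp
    · simp [h]

/-- The coordinates of a homogeneous element are homogeneous. -/
theorem repr_mem_gr {F : GradedOIModule A} (f : F.HomogeneousBasis) {w : ℕ} {d : ℤ}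
    {x : F.obj w} (hx : x ∈ F.gr w d) (v : OIIndex f.width w) :
    (f.basisAt w).repr x v ∈ A.gr w (d - f.deg v.1) := by
  rw [← (F.isInternal w).component_of_mem hx, f.repr_component]
  exact (A.isInternal w).component_mem _ _

end HomogeneousBasis

namespace Hom

variable {F G H : GradedOIModule A}

/-- The identity morphism. -/
def id (F : GradedOIModule A) : F.Hom F where
  app _ := LinearMap.id
  naturality _ _ := rfl
  app_mem_gr _ _ _ h := h

/-- Composition of morphisms, `ψ` after `φ`. -/
def comp (ψ : G.Hom H) (φ : F.Hom G) : F.Hom H where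
  app w := ψ.app w ∘ₗ φ.app w
  naturality ε x := by simp [φ.naturality, ψ.naturality]
  app_mem_gr w d x h := ψ.app_mem_gr w d _ (φ.app_mem_gr w d x h)

@[simp]
theorem comp_app (ψ : G.Hom H) (φ : F.Hom G) (w : ℕ) (x : F.obj w) :
    (ψ.comp φ).app w x = ψ.app w (φ.app w x) := rfl

/-- The inverse of a morphism that is bijective in every width. -/
noncomputable def inv (φ : F.Hom G) (h : ∀ w, Function.Bijective (φ.app w)) : G.Hom F where
  app w := (LinearEquiv.ofBijective (φ.app w) (h w)).symm
  naturality ε x := by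
    rw [LinearEquiv.coe_coe, LinearEquiv.symm_apply_eq, LinearEquiv.ofBijective_apply,
      φ.naturality, LinearEquiv.coe_coe, LinearEquiv.apply_ofBijective_symm_apply]
  app_mem_gr w d x hx := by
    obtain ⟨y, rfl⟩ := (h w).2 x
    rw [LinearEquiv.coe_coe, LinearEquiv.ofBijective_symm_apply_apply]
    have : F.component w d y = y := (h w).1 <| by
      rw [φ.app_component, (G.isInternal w).component_of_mem hx]
    rw [← this]
    exact (F.isInternal w).component_mem d y

@[simp]
theorem app_inv_app (φ : F.Hom G) (h : ∀ w, Function.Bijective (φ.app w)) (w : ℕ) (x : G.obj w) :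
    φ.app w ((φ.inv h).app w x) = x :=
  LinearEquiv.apply_ofBijective_symm_apply (φ.app w) (h := h w) x

@[simp]
theorem inv_app_app (φ : F.Hom G) (h : ∀ w, Function.Bijective (φ.app w)) (w : ℕ) (x : F.obj w) :
    (φ.inv h).app w (φ.app w x) = x :=
  LinearEquiv.ofBijective_symm_apply_apply (φ.app w) (h := h w) x

/-- The image of a morphism. -/
def range (φ : F.Hom G) : OISubmodule G.toOIModule where
  carrier w := LinearMap.range (φ.app w)
  map_mem := by
    rintro m n ε _ ⟨x, rfl⟩
    exact ⟨F.map ε x, φ.naturality ε x⟩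

/-- The kernel of a morphism. -/
def ker (φ : F.Hom G) : OISubmodule F.toOIModule where
  carrier w := LinearMap.ker (φ.app w)
  map_mem ε x hx := by
    rw [LinearMap.mem_ker] at hx ⊢
    rw [φ.naturality, hx, map_zero]

/-- A homogeneous element of the image has a homogeneous preimage. -/
theorem exists_mem_gr_of_mem_range {φ : F.Hom G} {w : ℕ} {d : ℤ} {y : G.obj w}
    (hy : y ∈ G.gr w d) (h : y ∈ φ.range.carrier w) : ∃ x ∈ F.gr w d, φ.app w x = y := by
  obtain ⟨x, rfl⟩ := h
  exact ⟨F.component w d x, (F.isInternal w).component_mem d x,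
    by rw [φ.app_component, (G.isInternal w).component_of_mem hy]⟩

end Hom

namespace HomogeneousBasis

variable {F G H : GradedOIModule A}

/-- A submodule contains an element as soon as it contains the basis elements which occur in it. -/
theorem mem_of_repr (f : F.HomogeneousBasis) (N : OISubmodule F.toOIModule) {w : ℕ} {x : F.obj w}
    (h : ∀ v, (f.basisAt w).repr x v ≠ 0 → f.basisAt w v ∈ N.carrier w) : x ∈ N.carrier w := by
  rw [← (f.basisAt w).linearCombination_repr x, Finsupp.linearCombination_apply]
  exact Submodule.sum_mem _ fun v hv =>
    Submodule.smul_mem _ _ (h v (Finsupp.mem_support_iff.1 hv))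

/-- A submodule containing the images of the basis elements contains the image. -/
theorem range_le (f : F.HomogeneousBasis) (φ : F.Hom G) (N : OISubmodule G.toOIModule)
    (h : ∀ i, φ.app _ (f.elt i) ∈ N.carrier _) (w : ℕ) (x : F.obj w) :
    φ.app w x ∈ N.carrier w := by
  refine f.mem_of_repr ⟨fun w => (N.carrier w).comap (φ.app w), fun ε x hx => ?_⟩ fun v _ => ?_
  · rw [Submodule.mem_comap, φ.naturality]
    exact N.map_mem ε _ hx
  · rw [Submodule.mem_comap, f.basisAt_apply, φ.naturality]
    exact N.map_mem _ _ (h _)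

/-- The morphism out of a free module with prescribed values on a basis. -/
noncomputable def lift (f : F.HomogeneousBasis) (y : ∀ i, G.obj (f.width i))
    (hy : ∀ i, y i ∈ G.gr (f.width i) (f.deg i)) : F.Hom G where
  app w := (f.basisAt w).constr (A.obj w) fun v => G.map v.2 (y v.1)
  naturality {m n} ε x := by
    obtain ⟨c, rfl⟩ := (f.basisAt m).repr.symm.surjective x
    induction c using Finsupp.induction_linear with
    | zero => simp
    | add x y hx hy => simp only [map_add, hx, hy]
    | single v a =>
      have : F.map ε (f.basisAt m v) = f.basisAt n (OIIndex.push ε v) := by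
        rw [f.basisAt_apply, f.basisAt_apply, ← F.map_comp]
        rfl
      rw [Module.Basis.repr_symm_single, F.map_smul, map_smul, map_smul, this,
        Module.Basis.constr_basis, Module.Basis.constr_basis, G.map_smul, ← G.map_comp]
      rfl
  app_mem_gr w d x hx := by
    rw [Module.Basis.constr_apply, Finsupp.sum]
    refine AddSubgroup.sum_mem _ fun v _ => ?_
    have := G.smul_mem_gr w _ _ _ _ (f.repr_mem_gr hx v) (G.map_mem_gr v.2 _ _ (hy v.1))
    rwa [sub_add_cancel] at this

theorem lift_elt (f : F.HomogeneousBasis) (y : ∀ i, G.obj (f.width i))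
    (hy : ∀ i, y i ∈ G.gr (f.width i) (f.deg i)) (i : Fin f.rank) :
    (f.lift y hy).app _ (f.elt i) = y i := by
  have : f.elt i = f.basisAt _ ⟨i, RelEmbedding.refl _⟩ := by rw [f.basisAt_apply, F.map_id]
  rw [this]
  change (f.basisAt _).constr _ _ _ = _
  rw [Module.Basis.constr_basis, G.map_id]

/-- Two morphisms out of a free module which agree on a basis are equal. -/
theorem hom_ext (f : F.HomogeneousBasis) {φ ψ : F.Hom G}
    (h : ∀ i, φ.app _ (f.elt i) = ψ.app _ (f.elt i)) (w : ℕ) (x : F.obj w) :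
    φ.app w x = ψ.app w x := by
  have : φ.app w = ψ.app w := (f.basisAt w).ext fun v => by
    rw [f.basisAt_apply, φ.naturality, ψ.naturality, h]
  rw [this]

end HomogeneousBasis

/-- Finitely generated graded free modules are projective. -/
theorem IsFinFree.exists_lift {F G H : GradedOIModule A} (hF : F.IsFinFree) (φ : F.Hom H)
    (ψ : G.Hom H) (h : ∀ w x, φ.app w x ∈ ψ.range.carrier w) :
    ∃ χ : F.Hom G, ∀ w x, ψ.app w (χ.app w x) = φ.app w x := by
  obtain ⟨f⟩ := hF
  choose y hy hy' using fun i =>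
    Hom.exists_mem_gr_of_mem_range (φ.app_mem_gr _ _ _ (f.elt_mem_gr i)) (h _ (f.elt i))
  refine ⟨f.lift y hy, fun w x => f.hom_ext (φ := ψ.comp (f.lift y hy)) (fun i => ?_) w x⟩
  rw [Hom.comp_app, f.lift_elt, hy']

end GradedOIModule
end Graded

/-! ### The radical of a graded module and Nakayama's lemma -/

section Radical

variable {k : Type u} [CommRing k] {A : GradedOIAlgebra k}

theorem OIHom.eq_of_eq {m n : ℕ} (h : m = n) (ε δ : OIHom m n) : ε = δ := by
  subst h
  refine RelEmbedding.ext fun a => ?_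
  have := Subsingleton.elim (StrictMono.orderIsoOfSurjective ε ε.strictMono
    (Finite.surjective_of_injective ε.injective)) (StrictMono.orderIsoOfSurjective δ δ.strictMono
    (Finite.surjective_of_injective δ.injective))
  exact congrArg (fun e : Fin m ≃o Fin m => e a) this

theorem OIHom.le {m n : ℕ} (ε : OIHom m n) : m ≤ n := by
  simpa using Fintype.card_le_of_injective ε ε.injective

/-- `A` is concentrated in non-negative degrees, and in every width its degree zero part is a
field. Polynomial `OI`-algebras over fields with generators of positive degrees are of this kind,
and this is all that minimality needs to know about them. -/
structure GradedOIAlgebra.IsConnected (A : GradedOIAlgebra k) : Prop where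
  eq_zero_of_neg : ∀ w d, d < 0 → ∀ a ∈ A.gr w d, a = 0
  isUnit_of_ne_zero : ∀ w, ∀ a ∈ A.gr w 0, a ≠ 0 → IsUnit a
  nontrivial : ∀ w, Nontrivial (A.obj w)

namespace GradedOIAlgebra

theorem component_mul (A : GradedOIAlgebra k) (w : ℕ) (d e : ℤ) {a : A.obj w} (b : A.obj w)
    (ha : a ∈ A.gr w e) :
    (A.isInternal w).component d (a * b) = a * (A.isInternal w).component (d - e) b := by
  have := A.gradedMonoid w
  induction b using (A.isInternal w).homogeneous_induction with
  | hom c b hb =>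
    rw [(A.isInternal w).component_apply (e + c) d (SetLike.mul_mem_graded ha hb),
      (A.isInternal w).component_apply c (d - e) hb]
    by_cases h : c = d - e
    · rw [if_pos h, if_pos (by lia)]
    · rw [if_neg h, if_neg (by lia), mul_zero]
  | add b c hb hc => simp [mul_add, hb, hc]

/-- The irrelevant ideal, generated by the elements of positive degree. -/
def irrelevant (A : GradedOIAlgebra k) (w : ℕ) : Ideal (A.obj w) :=
  Ideal.span {a | ∃ d > 0, a ∈ A.gr w d}

theorem IsConnected.not_isUnit_of_mem_irrelevant (hA : A.IsConnected) {w : ℕ} {a : A.obj w}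
    (ha : a ∈ A.irrelevant w) : ¬ IsUnit a := by
  intro hu
  have key : ∀ x ∈ A.irrelevant w, ∀ d ≤ 0, (A.isInternal w).component d x = 0 := by
    intro x hx
    induction hx using Submodule.span_induction with
    | mem x hx =>
      obtain ⟨e, he, hx⟩ := hx
      exact fun d hd => (A.isInternal w).component_of_mem_ne hx (by lia)
    | zero => simp
    | add x y _ _ hx hy => exact fun d hd => by rw [map_add, hx d hd, hy d hd, add_zero]
    | smul b x _ hx =>
      induction b using (A.isInternal w).homogeneous_induction with
      | hom e b hb =>
        intro d hd
        rcases lt_or_ge e 0 with he | he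
        · rw [hA.eq_zero_of_neg w e he b hb, zero_smul, map_zero]
        · rw [smul_eq_mul, A.component_mul w d e x hb, hx _ (by lia), mul_zero]
      | add b c hb hc =>
        exact fun d hd => by rw [add_smul, map_add, hb d hd, hc d hd, add_zero]
  have h1 : (1 : A.obj w) ∈ A.irrelevant w := by
    rw [Ideal.eq_top_of_isUnit_mem _ ha hu]
    exact Submodule.mem_top
  have h0 : (1 : A.obj w) ∈ A.gr w 0 := (A.gradedMonoid w).one_mem
  have := hA.nontrivial w
  exact one_ne_zero (((A.isInternal w).component_of_mem h0).symm.trans (key 1 h1 0 le_rfl))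

end GradedOIAlgebra

/-- The preimage of a submodule under a morphism. -/
def OISubmodule.comap {F G : GradedOIModule A} (N : OISubmodule G.toOIModule) (φ : F.Hom G) :
    OISubmodule F.toOIModule where
  carrier w := (N.carrier w).comap (φ.app w)
  map_mem ε x hx := by
    rw [Submodule.mem_comap, φ.naturality]
    exact N.map_mem ε _ hx

namespace GradedOIModule

/-- The submodule generated by `A₊ F` and, in each width, by the images of all smaller widths.
It plays the part of `𝔪 F` for a module over a local ring. -/
def radical (F : GradedOIModule A) : OISubmodule F.toOIModule where
  carrier w := Submodule.span (A.obj w)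
    ({x | ∃ d > 0, ∃ a ∈ A.gr w d, ∃ y, a • y = x} ∪
      {x | ∃ m < w, ∃ (ε : OIHom m w) (y : F.obj m), F.map ε y = x})
  map_mem {m n} ε x hx := by
    induction hx using Submodule.span_induction with
    | mem x hx =>
      refine Submodule.subset_span ?_
      rcases hx with ⟨d, hd, a, ha, y, rfl⟩ | ⟨l, hl, δ, y, rfl⟩
      · exact Or.inl ⟨d, hd, A.map ε a, A.map_mem_gr ε d a ha, F.map ε y, (F.map_smul _ _ _).symm⟩
      · exact Or.inr ⟨l, hl.trans_le ε.le, δ.trans ε, y, F.map_comp _ _ _⟩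
    | zero => rw [map_zero]; exact zero_mem _
    | add x y _ _ hx hy => rw [map_add]; exact add_mem hx hy
    | smul a x _ hx => rw [F.map_smul]; exact Submodule.smul_mem _ _ hx

namespace HomogeneousBasis

variable {F : GradedOIModule A}

/-- The image of a smaller width involves no basis element of width `w`. -/
theorem repr_map_eq_zero (f : F.HomogeneousBasis) {m w : ℕ} (hm : m < w) (ε : OIHom m w)
    (x : F.obj m) (v : OIIndex f.width w) (hv : f.width v.1 = w) :
    (f.basisAt w).repr (F.map ε x) v = 0 := by
  obtain ⟨c, rfl⟩ := (f.basisAt m).repr.symm.surjective x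
  induction c using Finsupp.induction_linear with
  | zero => simp
  | add x y hx hy => simp only [map_add, Finsupp.add_apply, hx, hy, add_zero]
  | single v' a =>
    have : F.map ε (f.basisAt m v') = f.basisAt w (OIIndex.push ε v') := by
      rw [f.basisAt_apply, f.basisAt_apply, ← F.map_comp]
      rfl
    rw [Module.Basis.repr_symm_single, F.map_smul, this, map_smul, Module.Basis.repr_self,
      Finsupp.smul_single, Finsupp.single_eq_of_ne]
    rintro rfl
    have := v'.2.le
    simp only [OIIndex.push] at hv
    lia

theorem not_isUnit_repr_of_mem_radical (hA : A.IsConnected) (f : F.HomogeneousBasis) {w : ℕ}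
    {x : F.obj w} (hx : x ∈ F.radical.carrier w) (v : OIIndex f.width w)
    (hv : f.width v.1 = w) : ¬ IsUnit ((f.basisAt w).repr x v) := by
  refine hA.not_isUnit_of_mem_irrelevant ?_
  suffices F.radical.carrier w ≤
      Submodule.comap ((f.basisAt w).coord v) (A.irrelevant w) from this hx
  refine Submodule.span_le.2 ?_
  rintro _ (⟨d, hd, a, ha, y, rfl⟩ | ⟨m, hm, ε, y, rfl⟩)
  · change (f.basisAt w).repr (a • y) v ∈ A.irrelevant w
    rw [map_smul, Finsupp.smul_apply]
    exact Ideal.mul_mem_right _ _ (Ideal.subset_span ⟨d, hd, ha⟩)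
  · change (f.basisAt w).repr (F.map ε y) v ∈ A.irrelevant w
    rw [f.repr_map_eq_zero hm ε y v hv]
    exact zero_mem _

theorem mem_radical_of_not_isUnit (hA : A.IsConnected) (f : F.HomogeneousBasis) {w : ℕ} {d : ℤ}
    {x : F.obj w} (hx : x ∈ F.gr w d)
    (h : ∀ v : OIIndex f.width w, f.width v.1 = w → ¬ IsUnit ((f.basisAt w).repr x v)) :
    x ∈ F.radical.carrier w := by
  rw [← (f.basisAt w).linearCombination_repr x, Finsupp.linearCombination_apply]
  refine Submodule.sum_mem _ fun v _ => ?_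
  dsimp only
  rcases v.2.le.lt_or_eq with hv | hv
  · refine Submodule.smul_mem _ _ (Submodule.subset_span (Or.inr ?_))
    exact ⟨_, hv, v.2, f.elt v.1, (f.basisAt_apply w v).symm⟩
  · have hc := f.repr_mem_gr hx v
    by_cases h0 : (f.basisAt w).repr x v = 0
    · rw [h0, zero_smul]
      exact zero_mem _
    · refine Submodule.subset_span (Or.inl ⟨_, ?_, _, hc, _, rfl⟩)
      rcases lt_trichotomy (d - f.deg v.1) 0 with hd | hd | hd
      · exact absurd (hA.eq_zero_of_neg w _ hd _ hc) h0
      · rw [hd] at hc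
        exact absurd (hA.isUnit_of_ne_zero w _ hc h0) (h v hv)
      · exact hd

/-- Nakayama's lemma: a morphism to a finitely generated graded free module which is surjective
modulo the radical is surjective. -/
theorem surjective_of_sub_mem_radical (hA : A.IsConnected) (f : F.HomogeneousBasis)
    {P : GradedOIModule A} (φ : P.Hom F)
    (h : ∀ j, ∃ z ∈ P.gr (f.width j) (f.deg j), f.elt j - φ.app _ z ∈ F.radical.carrier _)
    (w : ℕ) : Function.Surjective (φ.app w) := by
  -- The coefficients of an element of the radical of degree `deg j` and width `width j` can only
  -- sit at basis elements which precede `f.elt j` for the lexicographic order of (degree, width).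
  let r (i j : Fin f.rank) : Prop := toLex (f.deg i, f.width i) < toLex (f.deg j, f.width j)
  have : IsTrans _ r := ⟨fun _ _ _ => lt_trans⟩
  have : Std.Irrefl r := ⟨fun _ => lt_irrefl _⟩
  have key : ∀ j, f.elt j ∈ φ.range.carrier _ := by
    intro j
    induction j using (Finite.wellFounded_of_trans_of_irrefl r).induction with
    | _ j ih =>
      obtain ⟨z, hz, hr⟩ := h j
      rw [← sub_add_cancel (f.elt j) (φ.app _ z)]
      refine add_mem (f.mem_of_repr _ fun v hv => ?_) ⟨z, rfl⟩
      rw [f.basisAt_apply]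
      refine φ.range.map_mem _ _ (ih _ (Prod.Lex.toLex_lt_toLex.2 ?_))
      have hc := f.repr_mem_gr
        (AddSubgroup.sub_mem _ (f.elt_mem_gr j) (φ.app_mem_gr _ _ _ hz)) v
      rcases lt_trichotomy (f.deg j - f.deg v.1) 0 with hd | hd | hd
      · exact absurd (hA.eq_zero_of_neg _ _ hd _ hc) hv
      · refine Or.inr ⟨by lia, v.2.le.lt_of_ne fun hw => ?_⟩
        rw [hd] at hc
        exact f.not_isUnit_repr_of_mem_radical hA hr v hw (hA.isUnit_of_ne_zero _ _ hc hv)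
      · exact Or.inl (by lia)
  exact fun x => f.mem_of_repr φ.range fun v _ => by
    rw [f.basisAt_apply]
    exact φ.range.map_mem _ _ (key _)

/-- An endomorphism of a finitely generated graded free module is bijective if it is surjective
modulo the radical. -/
theorem bijective_of_sub_mem_radical (hA : A.IsConnected) (f : F.HomogeneousBasis) (φ : F.Hom F)
    (h : ∀ w d, ∀ y ∈ F.gr w d, ∃ z ∈ F.gr w d, y - φ.app _ z ∈ F.radical.carrier w)
    (w : ℕ) : Function.Bijective (φ.app w) := by
  have hs := f.surjective_of_sub_mem_radical hA φ (fun j => h _ _ _ (f.elt_mem_gr j)) w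
  have : Finite (OIIndex f.width w) := inferInstance
  have : Module.Finite (A.obj w) (F.obj w) := Module.Finite.of_basis (f.basisAt w)
  exact ⟨OrzechProperty.injective_of_surjective_endomorphism _ hs, hs⟩

end HomogeneousBasis

namespace Hom

variable {F G : GradedOIModule A}

theorem isMinimal_of_mem_radical (hA : A.IsConnected) (φ : F.Hom G)
    (h : ∀ w d, ∀ x ∈ F.gr w d, φ.app w x ∈ G.radical.carrier w) : φ.IsMinimal :=
  fun f g i _ hij => g.not_isUnit_repr_of_mem_radical hA (h _ _ _ (f.elt_mem_gr i)) _ hij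

theorem IsMinimal.app_mem_radical (hA : A.IsConnected) {φ : F.Hom G} (hφ : φ.IsMinimal)
    (hF : F.IsFinFree) (hG : G.IsFinFree) (w : ℕ) (x : F.obj w) :
    φ.app w x ∈ G.radical.carrier w := by
  obtain ⟨f⟩ := hF
  obtain ⟨g⟩ := hG
  refine f.range_le φ G.radical (fun i => ?_) w x
  refine g.mem_radical_of_not_isUnit hA (φ.app_mem_gr _ _ _ (f.elt_mem_gr i)) fun v hv => ?_
  have : v = ⟨v.1, (Fin.castOrderIso hv).toOrderEmbedding⟩ :=
    Sigma.ext rfl (heq_of_eq (OIHom.eq_of_eq hv _ _))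
  rw [this]
  exact hφ f g i v.1 hv

end Hom

end GradedOIModule

end Radical

/-! ### Free modules on a prescribed basis, and minimal covers -/

section Free

variable {k : Type u} [CommRing k]

/-- The graded free module with basis elements of the given widths and degrees. -/
noncomputable def GradedOIModule.free (A : GradedOIAlgebra k) {r : ℕ} (width : Fin r → ℕ)
    (deg : Fin r → ℤ) : GradedOIModule A where
  obj w := OIIndex width w →₀ A.obj w
  map ε := (Finsupp.mapDomain.addMonoidHom (OIIndex.push ε)).comp
    (Finsupp.mapRange.addMonoidHom (A.map ε : _ →+ _))
  map_id w x := by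
    have : (OIIndex.push (RelEmbedding.refl _) : OIIndex width w → _) = fun v => v := rfl
    change Finsupp.mapDomain (OIIndex.push (RelEmbedding.refl _))
      (Finsupp.mapRange (A.map (RelEmbedding.refl _)) (map_zero _) x) = x
    rw [this]
    refine Finsupp.mapDomain_id.trans ?_
    ext v
    exact A.map_id w _
  map_comp ε δ x := by
    induction x using Finsupp.induction_linear with
    | zero => simp
    | add x y hx hy => simp only [map_add, hx, hy]
    | single v a => simp [OIIndex.push, A.map_comp]; rfl
  map_smul ε a x := by
    induction x using Finsupp.induction_linear with
    | zero => simp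
    | add x y hx hy => simp only [map_add, smul_add, hx, hy]
    | single v b =>
      change Finsupp.mapDomain (OIIndex.push ε) (Finsupp.mapRange (A.map ε) (map_zero _)
        (a • Finsupp.single v b)) = A.map ε a • Finsupp.mapDomain (OIIndex.push ε)
        (Finsupp.mapRange (A.map ε) (map_zero _) (Finsupp.single v b))
      rw [Finsupp.smul_single, smul_eq_mul]
      simp only [Finsupp.mapRange_single, Finsupp.mapDomain_single, Finsupp.smul_single,
        smul_eq_mul, map_mul]
  gr w d :=
    { carrier := {x | ∀ v, x v ∈ A.gr w (d - deg v.1)}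
      add_mem' := fun {x y} hx hy v => (A.gr w (d - deg v.1)).add_mem (hx v) (hy v)
      zero_mem' := fun v => (A.gr w (d - deg v.1)).zero_mem
      neg_mem' := fun {x} hx v => (A.gr w (d - deg v.1)).neg_mem (hx v) }
  smul_mem_gr w c d a x ha hx v := by
    have := A.gradedMonoid w
    have h := SetLike.mul_mem_graded ha (hx v)
    rwa [← add_sub_assoc] at h
  isInternal w := by
    let π (d : ℤ) : (OIIndex width w →₀ A.obj w) →+ (OIIndex width w →₀ A.obj w) :=
      { toFun := fun x => Finsupp.onFinset x.support
          (fun v => (A.isInternal w).component (d - deg v.1) (x v)) fun v hv => by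
            rw [Finsupp.mem_support_iff]
            intro h
            rw [h, map_zero] at hv
            exact hv rfl
        map_zero' := by ext v; simp
        map_add' := fun x y => by ext v; simp }
    refine DirectSum.IsInternal.of_projections π (fun d e x hx => ?_) fun x => ?_
    · ext v
      change (A.isInternal w).component (d - deg v.1) (x v) = _
      rw [(A.isInternal w).component_apply _ _ (hx v)]
      by_cases h : e = d
      · rw [if_pos h, if_pos (by rw [h])]
      · rw [if_neg h, if_neg (by lia)]
        rfl
    · induction x using Finsupp.induction_linear with
      | zero => exact zero_mem _
      | add x y hx hy => exact add_mem hx hy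
      | single v a =>
        induction a using (A.isInternal w).homogeneous_induction with
        | hom c a ha =>
          refine AddSubgroup.mem_iSup_of_mem (c + deg v.1) fun v' => ?_
          rcases eq_or_ne v v' with rfl | h
          · simpa using ha
          · rw [Finsupp.single_eq_of_ne (Ne.symm h)]
            exact zero_mem _
        | add a b ha hb => rw [Finsupp.single_add]; exact add_mem ha hb
  map_mem_gr {m n} ε d x hx v := by
    classical
    change Finsupp.mapDomain (OIIndex.push ε) (Finsupp.mapRange (A.map ε) (map_zero _) x) v ∈ _
    rw [Finsupp.mapDomain, Finsupp.sum_apply, Finsupp.sum]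
    refine Submodule.sum_mem _ fun v' _ => ?_
    rw [Finsupp.single_apply]
    split_ifs with h
    · subst h
      exact A.map_mem_gr ε _ _ (hx v')
    · exact zero_mem _

/-- The standard basis of `GradedOIModule.free`. -/
noncomputable def GradedOIModule.freeBasis (A : GradedOIAlgebra k) {r : ℕ} (width : Fin r → ℕ)
    (deg : Fin r → ℤ) : (GradedOIModule.free A width deg).HomogeneousBasis where
  rank := r
  width := width
  deg := deg
  elt i := (Finsupp.single ⟨i, RelEmbedding.refl _⟩ 1 : OIIndex width (width i) →₀ A.obj (width i))
  elt_mem_gr i v := by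
    classical
    rw [Finsupp.single_apply]
    split_ifs with h
    · subst h
      rw [sub_self]
      exact (A.gradedMonoid _).one_mem
    · exact zero_mem _
  basisAt w := Module.Basis.ofRepr (LinearEquiv.refl _ _)
  basisAt_apply w v := by
    change Finsupp.single v 1 = Finsupp.mapDomain (OIIndex.push v.2)
      (Finsupp.mapRange (A.map v.2) (map_zero _)
        (Finsupp.single (⟨v.1, RelEmbedding.refl _⟩ : OIIndex width _) 1))
    rw [Finsupp.mapRange_single, Finsupp.mapDomain_single, map_one]
    rfl

namespace GradedOIModule

variable {A : GradedOIAlgebra k}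

/-- The image of a finitely generated graded free module is also the image of one for which the
kernel lies in the radical. -/
theorem IsFinFree.exists_minimal_cover (hA : A.IsConnected) {F U : GradedOIModule A}
    (hF : F.IsFinFree) (φ : F.Hom U) :
    ∃ (P : GradedOIModule A) (c : P.Hom U), P.IsFinFree ∧
      (∀ w x, x ∈ c.range.carrier w ↔ x ∈ φ.range.carrier w) ∧
      ∀ w d, ∀ x ∈ P.gr w d, c.app w x = 0 → x ∈ P.radical.carrier w := by
  classical
  let Q (n : ℕ) : Prop := ∃ (P : GradedOIModule A) (f : P.HomogeneousBasis) (c : P.Hom U),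
    f.rank = n ∧ ∀ w x, x ∈ c.range.carrier w ↔ x ∈ φ.range.carrier w
  have hQ : ∃ n, Q n := by
    obtain ⟨f⟩ := hF
    exact ⟨_, F, f, φ, rfl, fun _ _ => Iff.rfl⟩
  -- A cover of minimal rank will do.
  obtain ⟨P, f, c, hrank, hc⟩ := Nat.find_spec hQ
  refine ⟨P, c, ⟨f⟩, hc, fun w d x hx hcx => f.mem_radical_of_not_isUnit hA hx fun v hv hu => ?_⟩
  -- Otherwise the basis element with a unit coefficient is redundant.
  obtain ⟨j, ε⟩ := v
  dsimp only at hv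
  subst hv
  let e := Fintype.equivFin {i // i ≠ j}
  let f' := freeBasis A (fun i => f.width (e.symm i).1) (fun i => f.deg (e.symm i).1)
  let c' := f'.lift (fun i => c.app _ (f.elt (e.symm i).1))
    fun i => c.app_mem_gr _ _ _ (f.elt_mem_gr _)
  have hne : ∀ i, i ≠ j → c.app _ (f.elt i) ∈ c'.range.carrier _ := by
    intro i hi
    obtain ⟨i', rfl⟩ : ∃ i', (e.symm i').1 = i := ⟨e ⟨i, hi⟩, by simp⟩
    exact ⟨_, f'.lift_elt _ _ i'⟩
  have hj : c.app _ (f.elt j) ∈ c'.range.carrier _ := by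
    have hb : f.elt j = f.basisAt _ ⟨j, ε⟩ := by
      rw [f.basisAt_apply, OIHom.eq_of_eq rfl ε (RelEmbedding.refl _), P.map_id]
    set a := (f.basisAt _).repr x ⟨j, ε⟩ with ha
    have hmem : x - a • f.elt j ∈ (c'.range.comap c).carrier _ := by
      refine f.mem_of_repr _ fun v hv => ?_
      change c.app _ _ ∈ c'.range.carrier _
      rw [f.basisAt_apply, c.naturality]
      refine c'.range.map_mem _ _ (hne _ fun hvj => hv ?_)
      obtain ⟨i, δ⟩ := v
      dsimp only at hvj
      subst hvj
      rw [OIHom.eq_of_eq rfl δ ε, hb, map_sub, map_smul, Module.Basis.repr_self]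
      simp [ha]
    change c.app _ _ ∈ c'.range.carrier _ at hmem
    rw [map_sub, hcx, zero_sub, map_smul] at hmem
    obtain ⟨b, hb⟩ := hu.exists_left_inv
    have := Submodule.smul_mem _ b (neg_mem hmem)
    rwa [neg_neg, smul_smul, hb, one_smul] at this
  refine Nat.find_min hQ (m := Fintype.card {i // i ≠ j}) ?_ ⟨_, f', c', rfl, fun w x => ?_⟩
  · rw [← hrank]
    simpa using Fintype.card_subtype_lt (p := fun i => i ≠ j) (x := j) (by simp)
  · rw [← hc w x]
    constructor
    · rintro ⟨y, rfl⟩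
      refine f'.range_le c' c.range (fun i => ?_) w y
      rw [f'.lift_elt]
      exact ⟨_, rfl⟩
    · rintro ⟨y, rfl⟩
      refine f.range_le c c'.range (fun i => ?_) w y
      by_cases hi : i = j
      · subst hi
        exact hj
      · exact hne i hi

end GradedOIModule

end Free

/-! ### Minimal resolutions inside a given resolution -/

section Resolutions

variable {k : Type u} [CommRing k] {A : GradedOIAlgebra k} {M : GradedOIModule A}

namespace FreeOIResolution

/-- The targets `M, F₀, F₁, …` of the maps of the augmented resolution. -/
def target (F : FreeOIResolution M) : ℕ → GradedOIModule A
  | 0 => M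
  | n + 1 => F.X n

/-- The maps `F₀ → M, F₁ → F₀, F₂ → F₁, …` of the augmented resolution. -/
def augmented (F : FreeOIResolution M) : ∀ n, (F.X n).Hom (F.target n)
  | 0 => F.aug
  | n + 1 => F.d n

theorem exact_augmented (F : FreeOIResolution M) (n w : ℕ) :
    Function.Exact ((F.augmented (n + 1)).app w) ((F.augmented n).app w) := by
  cases n with
  | zero => exact F.exact_aug w
  | succ n => exact F.exact_d n w

/-- A module `U` (in the end `M` or the preceding module of the minimal resolution) which is a
direct summand, via `s` and `p`, of the target of the `n`-th map of the augmented resolution,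
compatibly with the image of that map. -/
structure Stage (F : FreeOIResolution M) (n : ℕ) where
  U : GradedOIModule A
  s : U.Hom (F.target n)
  p : (F.target n).Hom U
  p_s : ∀ w x, p.app w (s.app w x) = x
  s_p_mem : ∀ w x, s.app w (p.app w ((F.augmented n).app w x)) ∈ (F.augmented n).range.carrier w

/-- A minimal cover of the image of the `n`-th map in `U`, which is a direct summand of the free
module `F.X n` compatibly with the summand `U` of the target. -/
structure Stage.Cover {F : FreeOIResolution M} {n : ℕ} (σ : F.Stage n) where
  P : GradedOIModule A
  free : P.IsFinFree
  c : P.Hom σ.U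
  s : P.Hom (F.X n)
  p : (F.X n).Hom P
  p_s : ∀ w x, p.app w (s.app w x) = x
  range_c : ∀ w x, x ∈ c.range.carrier w ↔ x ∈ (σ.p.comp (F.augmented n)).range.carrier w
  mem_radical : ∀ w d, ∀ x ∈ P.gr w d, c.app w x = 0 → x ∈ P.radical.carrier w
  augmented_s : ∀ w x, (F.augmented n).app w (s.app w x) = σ.s.app w (c.app w x)
  c_p : ∀ w x, c.app w (p.app w x) = σ.p.app w ((F.augmented n).app w x)

theorem Stage.nonempty_cover (hA : A.IsConnected) {F : FreeOIResolution M} {n : ℕ}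
    (σ : F.Stage n) : Nonempty σ.Cover := by
  obtain ⟨P, c, hP, hc, hrad⟩ :=
    (F.free n).exists_minimal_cover hA (σ.p.comp (F.augmented n))
  obtain ⟨s, hs⟩ := hP.exists_lift (σ.s.comp c) (F.augmented n) fun w x => by
    obtain ⟨y, hy⟩ := (hc w (c.app w x)).1 ⟨x, rfl⟩
    rw [GradedOIModule.Hom.comp_app, ← hy]
    exact σ.s_p_mem w y
  obtain ⟨p, hp⟩ := (F.free n).exists_lift (σ.p.comp (F.augmented n)) c fun w x =>
    (hc w _).2 ⟨x, rfl⟩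
  have hps : ∀ w x, c.app w ((p.comp s).app w x) = c.app w x := fun w x => by
    rw [GradedOIModule.Hom.comp_app, hp, GradedOIModule.Hom.comp_app, hs,
      GradedOIModule.Hom.comp_app, σ.p_s]
  -- The endomorphism `p ∘ s` is the identity modulo the radical, so it can be divided out.
  have hbij : ∀ w, Function.Bijective ((p.comp s).app w) := by
    obtain ⟨f⟩ := hP
    refine f.bijective_of_sub_mem_radical hA _ fun w d y hy => ⟨y, hy, hrad w d _ ?_ ?_⟩
    · exact AddSubgroup.sub_mem _ hy ((p.comp s).app_mem_gr w d y hy)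
    · rw [map_sub, hps, sub_self]
  refine ⟨⟨P, hP, c, s, ((p.comp s).inv hbij).comp p, fun w x => ?_, hc, hrad, hs, fun w x => ?_⟩⟩
  · exact GradedOIModule.Hom.inv_app_app (p.comp s) hbij w x
  · rw [GradedOIModule.Hom.comp_app, ← hps, GradedOIModule.Hom.app_inv_app, hp]
    rfl

/-- The next stage: the minimal cover itself. -/
def Stage.Cover.next {F : FreeOIResolution M} {n : ℕ} {σ : F.Stage n} (C : σ.Cover) :
    F.Stage (n + 1) where
  U := C.P
  s := C.s
  p := C.p
  p_s := C.p_s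
  s_p_mem w x := by
    refine (F.exact_augmented n w _).1 ?_
    have h := (F.exact_augmented n w).apply_apply_eq_zero x
    refine (C.augmented_s w _).trans ((congrArg (σ.s.app w) ((C.c_p w _).trans ?_)).trans
      (map_zero _))
    rw [h, map_zero]

theorem Stage.Cover.range_next {F : FreeOIResolution M} {n : ℕ} {σ : F.Stage n} (C : σ.Cover)
    (w : ℕ) (x : C.P.obj w) :
    x ∈ (C.next.p.comp (F.augmented (n + 1))).range.carrier w ↔ C.c.app w x = 0 := by
  constructor
  · rintro ⟨y, rfl⟩
    refine (C.c_p w _).trans ?_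
    rw [(F.exact_augmented n w).apply_apply_eq_zero y, map_zero]
  · intro hx
    obtain ⟨y, hy⟩ := (F.exact_augmented n w (C.s.app w x)).1 (by rw [C.augmented_s, hx, map_zero])
    refine ⟨y, ?_⟩
    change C.p.app w _ = x
    rw [hy, C.p_s]

/-- The recursively defined stages, starting from `M` itself. -/
noncomputable def stage (hA : A.IsConnected) (F : FreeOIResolution M) : ∀ n, F.Stage n
  | 0 =>
    { U := M
      s := GradedOIModule.Hom.id M
      p := GradedOIModule.Hom.id M
      p_s := fun _ _ => rfl
      s_p_mem := fun _ x => ⟨x, rfl⟩ }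
  | n + 1 => ((F.stage hA n).nonempty_cover hA).some.next

/-- The minimal cover at each stage. -/
noncomputable def cover (hA : A.IsConnected) (F : FreeOIResolution M) (n : ℕ) :
    (F.stage hA n).Cover :=
  ((F.stage hA n).nonempty_cover hA).some

/-- The minimal covers fit together to a resolution. -/
noncomputable def minimalPart (hA : A.IsConnected) (F : FreeOIResolution M) :
    FreeOIResolution M where
  X n := (F.cover hA n).P
  free n := (F.cover hA n).free
  d n := (F.cover hA (n + 1)).c
  aug := (F.cover hA 0).c
  aug_surjective w x := by
    obtain ⟨y, hy⟩ := F.aug_surjective w x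
    exact ((F.cover hA 0).range_c w x).2 ⟨y, hy⟩
  exact_aug w x :=
    (((F.cover hA 1).range_c w x).trans ((F.cover hA 0).range_next w x)).symm
  exact_d i w x :=
    (((F.cover hA (i + 2)).range_c w x).trans ((F.cover hA (i + 1)).range_next w x)).symm

theorem isMinimal_minimalPart (hA : A.IsConnected) (F : FreeOIResolution M) :
    (F.minimalPart hA).IsMinimal := by
  intro n
  refine GradedOIModule.Hom.isMinimal_of_mem_radical hA _ fun w d x hx => ?_
  refine (F.cover hA n).mem_radical w d _ (((F.minimalPart hA).d n).app_mem_gr w d x hx) ?_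
  have := ((F.minimalPart hA).exact_augmented n w).apply_apply_eq_zero x
  cases n <;> exact this

theorem minimalPart_isDirectSummand (hA : A.IsConnected) (F : FreeOIResolution M) :
    (F.minimalPart hA).IsDirectSummand F := by
  refine ⟨⟨fun n => (F.cover hA n).s, fun i w x => ?_, fun w x => ?_⟩,
    ⟨fun n => (F.cover hA n).p, fun i w x => ?_, fun w x => ?_⟩, fun n => (F.cover hA n).p_s⟩
  · exact ((F.cover hA (i + 1)).augmented_s w x).symm
  · exact (F.cover hA 0).augmented_s w x
  · exact ((F.cover hA (i + 1)).c_p w x).symm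
  · exact (F.cover hA 0).c_p w x

/-! ### Uniqueness of minimal resolutions -/

/-- The comparison map between two free resolutions. -/
theorem nonempty_hom (F G : FreeOIResolution M) : Nonempty (F.Hom G) := by
  let S (i : ℕ) := {a : (F.X i).Hom (G.X i) // ∀ w x,
    a.app w ((F.d i).app w x) ∈ (G.d i).range.carrier w}
  have h0 : ∃ a : S 0, ∀ w x, G.aug.app w (a.1.app w x) = F.aug.app w x := by
    obtain ⟨a, ha⟩ := (F.free 0).exists_lift F.aug G.aug fun w x => G.aug_surjective w _
    refine ⟨⟨a, fun w x => (G.exact_aug w _).1 ?_⟩, ha⟩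
    rw [ha, (F.exact_aug w).apply_apply_eq_zero]
  have hstep : ∀ i (a : S i), ∃ b : S (i + 1), ∀ w x,
      a.1.app w ((F.d i).app w x) = (G.d i).app w (b.1.app w x) := by
    intro i a
    obtain ⟨b, hb⟩ := (F.free (i + 1)).exists_lift (a.1.comp (F.d i)) (G.d i) a.2
    refine ⟨⟨b, fun w x => (G.exact_d i w _).1 ?_⟩, fun w x => (hb w x).symm⟩
    rw [hb, GradedOIModule.Hom.comp_app, (F.exact_d i w).apply_apply_eq_zero, map_zero]
  obtain ⟨a0, ha0⟩ := h0
  choose next hnext using hstep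
  let a (i : ℕ) : S i := Nat.rec a0 next i
  exact ⟨⟨fun i => (a i).1, fun i => hnext i (a i), ha0⟩⟩

/-- Composition of maps of resolutions, `t` after `s`. -/
def Hom.comp {F G H : FreeOIResolution M} (t : G.Hom H) (s : F.Hom G) : F.Hom H where
  f i := (t.f i).comp (s.f i)
  comm i w x := by simp [s.comm, t.comm]
  comm_aug w x := by simp [s.comm_aug, t.comm_aug]

/-- Every endomorphism of a minimal resolution is an automorphism. -/
theorem IsMinimal.bijective (hA : A.IsConnected) {P : FreeOIResolution M} (hP : P.IsMinimal)
    (α : P.Hom P) (i w : ℕ) : Function.Bijective ((α.f i).app w) := by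
  -- It suffices to reach every element up to a boundary, as boundaries lie in the radical.
  have key : ∀ i, (∀ w d, ∀ y ∈ (P.X i).gr w d, ∃ z ∈ (P.X i).gr w d,
      y - (α.f i).app w z ∈ (P.d i).range.carrier w) →
      ∀ w, Function.Bijective ((α.f i).app w) := by
    intro i h
    obtain ⟨f⟩ := P.free i
    refine f.bijective_of_sub_mem_radical hA _ fun w d y hy => ?_
    obtain ⟨z, hz, x, hx⟩ := h w d y hy
    refine ⟨z, hz, ?_⟩
    rw [← hx]
    exact (hP i).app_mem_radical hA (P.free _) (P.free _) w x
  suffices H : ∀ i, (∀ w, Function.Bijective ((α.f i).app w)) ∧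
      ∀ w x, (α.f i).app w x ∈ (P.d i).range.carrier w → x ∈ (P.d i).range.carrier w from (H i).1 w
  intro i
  induction i with
  | zero =>
    refine ⟨key 0 fun w d y hy => ⟨y, hy, (P.exact_aug w _).1 ?_⟩, fun w x hx => ?_⟩
    · rw [map_sub, α.comm_aug, sub_self]
    · refine (P.exact_aug w _).1 ?_
      rw [← α.comm_aug]
      exact (P.exact_aug w _).2 hx
  | succ i ih =>
    refine ⟨key (i + 1) fun w d y hy => ?_, fun w x hx => ?_⟩
    · obtain ⟨x, hx⟩ := (ih.1 w).2 ((P.d i).app w y)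
      obtain ⟨z, rfl⟩ := ih.2 w x ⟨y, hx.symm⟩
      refine ⟨(P.X (i + 1)).component w d z, ((P.X (i + 1)).isInternal w).component_mem d z,
        (P.exact_d i w _).1 ?_⟩
      rw [map_sub, GradedOIModule.Hom.app_component, GradedOIModule.Hom.app_component, ← α.comm,
        hx, ← GradedOIModule.Hom.app_component,
        ((P.X (i + 1)).isInternal w).component_of_mem hy, sub_self]
    · refine (P.exact_d i w _).1 ((ih.1 w).1 ?_)
      rw [α.comm, map_zero]
      exact (P.exact_d i w _).2 hx

theorem IsMinimal.isIsomorphic (hA : A.IsConnected) {P Q : FreeOIResolution M}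
    (hP : P.IsMinimal) (hQ : Q.IsMinimal) : P.IsIsomorphic Q := by
  obtain ⟨s⟩ := nonempty_hom P Q
  obtain ⟨t⟩ := nonempty_hom Q P
  have hs : ∀ i w, Function.Bijective ((s.f i).app w) := fun i w =>
    ⟨Function.Injective.of_comp (f := (t.f i).app w) (hP.bijective hA (t.comp s) i w).1,
      Function.Surjective.of_comp (g := (t.f i).app w) (hQ.bijective hA (s.comp t) i w).2⟩
  refine ⟨s, ⟨fun i => (s.f i).inv (hs i), fun i w x => (hs i w).1 ?_, fun w x => ?_⟩,
    fun i w x => GradedOIModule.Hom.inv_app_app _ _ _ _,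
    fun i w x => GradedOIModule.Hom.app_inv_app _ _ _ _⟩
  · rw [GradedOIModule.Hom.app_inv_app, s.comm, GradedOIModule.Hom.app_inv_app]
  · rw [← s.comm_aug, GradedOIModule.Hom.app_inv_app]

end FreeOIResolution

/-! ### Construction of resolutions from finite generation of kernels -/

namespace GradedOIModule

/-- A finitely generated submodule which is closed under homogeneous components is the image of a
finitely generated graded free module. -/
theorem exists_range_eq_of_fg {U : GradedOIModule A} (N : OISubmodule U.toOIModule) (hN : N.FG)
    (hgr : ∀ w d, ∀ x ∈ N.carrier w, U.component w d x ∈ N.carrier w) :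
    ∃ (F : GradedOIModule A) (φ : F.Hom U), F.IsFinFree ∧
      ∀ w x, x ∈ φ.range.carrier w ↔ x ∈ N.carrier w := by
  obtain ⟨S, hS, hSN, hmin⟩ := hN
  choose s hs using fun g : Σ w, U.obj w => (U.isInternal g.1).exists_eq_sum_component g.2
  -- The homogeneous components of the generators, indexed by a finite type.
  have := hS.fintype
  let I := Σ g : S, {d // d ∈ s g.1}
  let e := Fintype.equivFin I
  let f := freeBasis A (fun i => (e.symm i).1.1.1) (fun i => (e.symm i).2.1)
  have hy : ∀ i, U.component (e.symm i).1.1.1 (e.symm i).2.1 (e.symm i).1.1.2 ∈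
      U.gr (f.width i) (f.deg i) := fun i => (U.isInternal _).component_mem _ _
  let φ := f.lift (fun i => U.component (e.symm i).1.1.1 (e.symm i).2.1 (e.symm i).1.1.2) hy
  refine ⟨_, φ, ⟨f⟩, fun w x => ⟨?_, fun hx => hmin φ.range ?_ w hx⟩⟩
  · rintro ⟨y, rfl⟩
    refine f.range_le φ N (fun i => ?_) w y
    rw [show φ.app _ (f.elt i) = _ from f.lift_elt _ hy i]
    exact hgr _ _ _ (hSN _ (e.symm i).1.2)
  · intro g hg
    rw [hs g]
    refine Submodule.sum_mem _ fun d hd => ?_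
    obtain ⟨i, hi⟩ := e.symm.surjective ⟨⟨g, hg⟩, ⟨d, hd⟩⟩
    have : ∀ j : I, e.symm i = j → U.component j.1.1.1 j.2.1 j.1.1.2 ∈ φ.range.carrier j.1.1.1 := by
      rintro _ rfl
      exact ⟨_, f.lift_elt _ hy i⟩
    exact this _ hi

end GradedOIModule

/-- If kernels of maps from finitely generated graded free modules are finitely generated, then
finitely generated graded modules have resolutions by finitely generated graded free modules. -/
theorem FreeOIResolution.nonempty_of_fg_ker (hM : M.FG)
    (hker : ∀ (F U : GradedOIModule A) (φ : F.Hom U), F.IsFinFree → φ.ker.FG) :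
    Nonempty (FreeOIResolution M) := by
  obtain ⟨F₀, φ₀, hF₀, h₀⟩ := GradedOIModule.exists_range_eq_of_fg M.top hM
    fun w d x _ => Submodule.mem_top
  let S := Σ' (F : GradedOIModule A) (U : GradedOIModule A) (_ : F.Hom U), F.IsFinFree
  have hstep : ∀ σ : S, ∃ (F : GradedOIModule A) (φ : F.Hom σ.1), F.IsFinFree ∧
      ∀ w x, x ∈ φ.range.carrier w ↔ σ.2.2.1.app w x = 0 := by
    rintro ⟨F, U, φ, hF⟩
    refine GradedOIModule.exists_range_eq_of_fg φ.ker (hker F U φ hF) fun w d x hx => ?_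
    change φ.app w _ = 0
    rw [φ.app_component, show φ.app w x = 0 from hx, map_zero]
  choose N ψ hN hψ using hstep
  let σ (n : ℕ) : S := Nat.rec ⟨F₀, M, φ₀, hF₀⟩ (fun _ σ => ⟨N σ, σ.1, ψ σ, hN σ⟩) n
  exact ⟨{
    X := fun n => (σ n).1
    free := fun n => (σ n).2.2.2
    d := fun n => ψ (σ n)
    aug := φ₀
    aug_surjective := fun w x => (h₀ w x).2 Submodule.mem_top
    exact_aug := fun w x => (hψ (σ 0) w x).symm
    exact_d := fun i w x => (hψ (σ (i + 1)) w x).symm }⟩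

end Resolutions

/-! ### Polynomial algebras are connected -/

section Connected

variable {k : Type u} [Field k] {A : GradedOIAlgebra k}

theorem GradedOIAlgebra.IsPolynomial.isConnected (hA : A.IsPolynomial) : A.IsConnected := by
  obtain ⟨r, n, deg, hdeg, ⟨E⟩⟩ := hA
  have hweight : ∀ w (m : OIIndex n w →₀ ℕ),
      Finsupp.weight (fun v : OIIndex n w => deg v.1) m = ∑ v ∈ m.support, m v * deg v.1 := by
    intro w m
    simp [Finsupp.weight_apply, Finsupp.sum]
  have hnonneg : ∀ w (m : OIIndex n w →₀ ℕ), ∀ v ∈ m.support, 0 ≤ (m v : ℤ) * deg v.1 :=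
    fun w m v _ => mul_nonneg (Int.natCast_nonneg _) (hdeg _).le
  have hhom : ∀ w d, ∀ a ∈ A.gr w d, ∀ m, (E.equiv w a).coeff m ≠ 0 →
      ∑ v ∈ m.support, (m v : ℤ) * deg v.1 = d := by
    intro w d a ha m hm
    rw [← hweight]
    exact ((MvPolynomial.mem_weightedHomogeneousSubmodule k _ d _).1
      ((E.mem_gr_iff w d a).2 ha)) hm
  refine ⟨fun w d hd a ha => ?_, fun w a ha h0 => ?_, fun w => ?_⟩
  · by_contra h
    obtain ⟨m, hm⟩ := MvPolynomial.ne_zero_iff.1 ((map_ne_zero_iff _ (E.equiv w).injective).2 h)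
    have := hhom w d a ha m hm
    have := Finset.sum_nonneg (hnonneg w m)
    lia
  · have hm0 : ∀ m, (E.equiv w a).coeff m ≠ 0 → m = 0 := by
      intro m hm
      ext v
      by_contra hv
      have h1 := (Finset.sum_eq_zero_iff_of_nonneg (hnonneg w m)).1 (hhom w 0 a ha m hm) v
        (Finsupp.mem_support_iff.2 hv)
      rcases mul_eq_zero.1 h1 with h | h
      · exact hv (by simpa using h)
      · exact (hdeg v.1).ne' h
    have hC : E.equiv w a = MvPolynomial.C ((E.equiv w a).coeff 0) := by
      classical
      refine MvPolynomial.ext (R := k) (σ := OIIndex n w) _ _ fun m => ?_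
      rw [MvPolynomial.coeff_C]
      split_ifs with h
      · rw [h]
      · by_contra h'
        exact h (hm0 m h').symm
    have hne : (E.equiv w a).coeff 0 ≠ 0 := by
      intro h
      rw [h, MvPolynomial.C_0] at hC
      exact h0 ((map_eq_zero_iff _ (E.equiv w).injective).1 hC)
    have : IsUnit (E.equiv w a) := by
      rw [hC]
      exact (IsUnit.mk0 _ hne).map (MvPolynomial.C (σ := OIIndex n w))
    exact (MulEquiv.isUnit_map (E.equiv w)).1 this
  · exact (E.equiv w).toEquiv.nontrivial_congr.2
      (inferInstanceAs (Nontrivial (MvPolynomial (OIIndex n w) k)))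

end Connected

/-! ### Noetherian polynomial algebras are generated in width at most one -/

/-- The image of `π` consists of consecutive integers. -/
def OIHom.IsWindow {N w : ℕ} (π : OIHom N w) : Prop :=
  ∀ a (h : a + 1 < N), (π ⟨a + 1, h⟩ : ℕ) = π ⟨a, by lia⟩ + 1

/-- The image of `π` consists of the first `N - 1` elements and the last element of `[w]`. -/
def OIHom.IsClosing {N w : ℕ} (π : OIHom N w) : Prop :=
  (∀ a : Fin N, (a : ℕ) + 1 < N → (π a : ℕ) = a) ∧
    ∀ a : Fin N, (a : ℕ) + 1 = N → (π a : ℕ) + 1 = w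

/-- The windows of `[u]` together with the closing subset form a "cycle", and no such cycle embeds
into a longer one: the closing subset of `[u]` has a gap, so its image is the closing subset again
and the end points are preserved; then windows go to windows, and there are no gaps. -/
theorem OIHom.eq_of_preserves_cycle {N u w : ℕ} (hN : 2 ≤ N) (hu : N < u) (ε : OIHom u w)
    (h : ∀ π : OIHom N u, π.IsWindow ∨ π.IsClosing →
      OIHom.IsWindow (π.trans ε : OIHom N w) ∨ OIHom.IsClosing (π.trans ε : OIHom N w)) :
    u = w := by
  have hlt : ∀ i j (hi : i < u) (hj : j < u), i < j → (ε ⟨i, hi⟩ : ℕ) < ε ⟨j, hj⟩ :=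
    fun i j hi hj hij => ε.strictMono (Fin.mk_lt_mk.2 hij)
  let π₀ : OIHom N u := OrderEmbedding.ofStrictMono
    (fun a => ⟨if (a : ℕ) + 1 < N then a else u - 1, by have := a.2; split_ifs <;> lia⟩) (by
      intro a b hab
      rw [Fin.lt_def] at hab ⊢
      have := b.2
      dsimp only
      split_ifs <;> lia)
  have hends : (ε ⟨0, by lia⟩ : ℕ) = 0 ∧ (ε ⟨u - 1, by lia⟩ : ℕ) + 1 = w := by
    have e0 : π₀ ⟨0, by lia⟩ = ⟨0, by lia⟩ := Fin.ext (if_pos (by dsimp only; lia))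
    have e1 : π₀ ⟨N - 2, by lia⟩ = ⟨N - 2, by lia⟩ := Fin.ext (if_pos (by dsimp only; lia))
    have e2 : π₀ ⟨N - 2 + 1, by lia⟩ = ⟨u - 1, by lia⟩ := Fin.ext (if_neg (by dsimp only; lia))
    rcases h π₀ (Or.inr ⟨fun a ha => if_pos ha, fun a ha => by
        have : (π₀ a : ℕ) = u - 1 := if_neg (by lia)
        lia⟩) with hw | hc
    · have := hw (N - 2) (by lia)
      rw [RelEmbedding.trans_apply, RelEmbedding.trans_apply, e1, e2] at this
      have h1 := hlt (N - 2) (N - 1) (by lia) (by lia) (by lia)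
      have h2 := hlt (N - 1) (u - 1) (by lia) (by lia) (by lia)
      lia
    · have h0 := hc.1 ⟨0, by lia⟩ (by dsimp only; lia)
      have h1 := hc.2 ⟨N - 2 + 1, by lia⟩ (by dsimp only; lia)
      rw [RelEmbedding.trans_apply, e0] at h0
      rw [RelEmbedding.trans_apply, e2] at h1
      exact ⟨h0, h1⟩
  have hsucc : ∀ j (hj : j + 1 < u), (ε ⟨j + 1, hj⟩ : ℕ) = ε ⟨j, by lia⟩ + 1 := by
    intro j hj
    -- A window containing both `j` and `j + 1`.
    obtain ⟨s, hs1, hs2, hs3⟩ : ∃ s, s ≤ j ∧ j + 1 < s + N ∧ s + N ≤ u := by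
      rcases le_total j (u - N) with h | h
      · exact ⟨j, by lia, by lia, by lia⟩
      · exact ⟨u - N, by lia, by lia, by lia⟩
    let π : OIHom N u := OrderEmbedding.ofStrictMono (fun a => ⟨s + a, by have := a.2; lia⟩) (by
      intro a b hab
      rw [Fin.lt_def] at hab ⊢
      dsimp only
      lia)
    have hπ : ∀ a (ha : a < N), π ⟨a, ha⟩ = ⟨s + a, by lia⟩ := fun _ _ => rfl
    rcases h π (Or.inl fun a ha => by rw [hπ, hπ]; rfl) with hw | hc
    · obtain ⟨t, rfl⟩ := Nat.exists_eq_add_of_le hs1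
      have := hw t (by lia)
      rw [RelEmbedding.trans_apply, RelEmbedding.trans_apply, hπ, hπ] at this
      exact this
    · exfalso
      have h0 := hc.1 ⟨0, by lia⟩ (by dsimp only; lia)
      have h1 := hc.2 ⟨N - 1, by lia⟩ (by dsimp only; lia)
      rw [RelEmbedding.trans_apply, hπ] at h0 h1
      have h2 : s = 0 := by
        by_contra hs
        have := hlt 0 (s + 0) (by lia) (by lia) (by lia)
        dsimp only at h0
        lia
      have := hlt (s + (N - 1)) (u - 1) (by lia) (by lia) (by lia)
      lia
  have hid : ∀ j (hj : j < u), (ε ⟨j, hj⟩ : ℕ) = j := by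
    intro j
    induction j with
    | zero => exact fun _ => hends.1
    | succ j ih => exact fun hj => by rw [hsucc j hj, ih]
  have := hends.2
  rw [hid] at this
  lia

theorem OIIndex.push_injective {r : ℕ} {n : Fin r → ℕ} {w w' : ℕ} (ε : OIHom w w') :
    Function.Injective (OIIndex.push ε : OIIndex n w → OIIndex n w') := by
  rintro ⟨i, π⟩ ⟨j, δ⟩ h
  obtain ⟨rfl, h⟩ := Sigma.mk.inj_iff.1 h
  have h := eq_of_heq h
  refine Sigma.ext rfl (heq_of_eq (RelEmbedding.ext fun a => ε.injective ?_))
  exact congrArg (fun e : OIHom _ w' => e a) h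

section Cycles

variable {r : ℕ} {n : Fin r → ℕ}

open Classical in
/-- The product of all variables of the `i`-th type indexed by a window or by the closing
subset. -/
noncomputable def cycleExponent (n : Fin r → ℕ) (i : Fin r) (w : ℕ) : OIIndex n w →₀ ℕ :=
  Finsupp.equivFunOnFinite.symm fun v =>
    if v.1 = i ∧ (OIHom.IsWindow v.2 ∨ OIHom.IsClosing v.2) then 1 else 0

theorem eq_of_mapDomain_cycleExponent_le {i : Fin r} (hi : 2 ≤ n i) {u w : ℕ} (hu : n i < u)
    (ε : OIHom u w)
    (h : (cycleExponent n i u).mapDomain (OIIndex.push ε) ≤ cycleExponent n i w) : u = w := by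
  refine OIHom.eq_of_preserves_cycle hi hu ε fun π hπ => ?_
  have := h (OIIndex.push ε ⟨i, π⟩)
  rw [Finsupp.mapDomain_apply (OIIndex.push_injective ε)] at this
  simp only [cycleExponent, Finsupp.equivFunOnFinite_symm_apply_apply] at this
  rw [if_pos ⟨rfl, hπ⟩] at this
  by_contra hcon
  rw [if_neg (fun h => hcon h.2)] at this
  exact absurd this (by norm_num)

variable {k : Type u} [Field k] {A : GradedOIAlgebra k} {deg : Fin r → ℤ}

/-- The ideal of the elements of `A(w)` all of whose monomials lie in an up-closed set `D`. -/
def monomialIdealAt (E : A.Iso (symOIAlgebra k n deg)) {w : ℕ} (D : Set (OIIndex n w →₀ ℕ))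
    (hadd : ∀ m ∈ D, ∀ a, a + m ∈ D) : Ideal (A.obj w) where
  carrier := {a | ∀ m, MvPolynomial.coeff m (E.equiv w a) ≠ 0 → m ∈ D}
  add_mem' {a b} ha hb m hm := by
    by_contra hD
    have h1 := not_not.1 (mt (ha m) hD)
    have h2 := not_not.1 (mt (hb m) hD)
    refine hm ?_
    rw [map_add]
    exact (MvPolynomial.coeff_add m _ _).trans (by rw [h1, h2, add_zero])
  zero_mem' m hm := absurd ((congrArg (MvPolynomial.coeff m)
    (map_zero (E.equiv w))).trans (MvPolynomial.coeff_zero m)) hm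
  smul_mem' b a ha m hm := by
    classical
    rw [smul_eq_mul, map_mul] at hm
    replace hm := (MvPolynomial.coeff_mul (σ := OIIndex n w) (R := k) _ _ m).symm.trans_ne hm
    obtain ⟨⟨x, y⟩, hxy, hne⟩ := Finset.exists_ne_zero_of_sum_ne_zero hm
    rw [← Finset.HasAntidiagonal.mem_antidiagonal.1 hxy]
    exact hadd _ (ha _ (right_ne_zero_of_mul hne)) _

/-- The ideal spanned by the monomials whose exponents lie in an up-closed family `D`. -/
def monomialIdeal (E : A.Iso (symOIAlgebra k n deg)) (D : ∀ w, Set (OIIndex n w →₀ ℕ))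
    (hadd : ∀ w, ∀ m ∈ D w, ∀ a, a + m ∈ D w)
    (hpush : ∀ w w' (ε : OIHom w w'), ∀ m ∈ D w, m.mapDomain (OIIndex.push ε) ∈ D w') :
    OISubmodule A.self where
  carrier w := monomialIdealAt E (D w) (hadd w)
  map_mem {w w'} ε a ha m hm := by
    replace hm : MvPolynomial.coeff m (E.equiv w' (A.map ε (show A.obj w from a))) ≠ 0 := hm
    rw [E.naturality] at hm
    obtain ⟨m', rfl, hm'⟩ := MvPolynomial.coeff_rename_ne_zero (R := k) _ _ _ hm
    exact hpush w w' ε m' (ha m' hm')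

/-- A noetherian polynomial algebra has no generators in width two or more: otherwise the ideal of
all multiples of the cycle monomials is not finitely generated. -/
theorem width_le_one_of_isNoetherian (E : A.Iso (symOIAlgebra k n deg)) (hA : A.IsNoetherian)
    (i : Fin r) : n i ≤ 1 := by
  by_contra! hi
  let D (W : Set ℕ) (w : ℕ) : Set (OIIndex n w →₀ ℕ) :=
    {m | ∃ u ∈ W, n i < u ∧ ∃ ε : OIHom u w, (cycleExponent n i u).mapDomain (OIIndex.push ε) ≤ m}
  have hadd : ∀ W w, ∀ m ∈ D W w, ∀ a, a + m ∈ D W w := by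
    rintro W w m ⟨u, hu, hu', ε, hε⟩ a
    exact ⟨u, hu, hu', ε, hε.trans (le_add_self)⟩
  have hpush : ∀ W w w' (ε : OIHom w w'), ∀ m ∈ D W w, m.mapDomain (OIIndex.push ε) ∈ D W w' := by
    rintro W w w' δ m ⟨u, hu, hu', ε, hε⟩
    refine ⟨u, hu, hu', ε.trans δ, ?_⟩
    have : (OIIndex.push (ε.trans δ : OIHom u w') : OIIndex n u → _)
        = OIIndex.push δ ∘ OIIndex.push ε := rfl
    rw [this, Finsupp.mapDomain_comp]
    obtain ⟨c, rfl⟩ := le_iff_exists_add.1 hε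
    rw [Finsupp.mapDomain_add]
    exact le_self_add
  let I (W : Set ℕ) : OISubmodule A.self := monomialIdeal E (D W) (hadd W) (hpush W)
  obtain ⟨G, hG, hGI, hmin⟩ := hA (I Set.univ)
  -- Every generator only involves cycles of bounded length.
  have hbound : ∀ g ∈ G, ∃ W : ℕ, g.2 ∈ (I (Set.Iic W)).carrier g.1 := by
    intro g hg
    have h := hGI g hg
    choose! u hu using fun m (hm : MvPolynomial.coeff m (E.equiv g.1 g.2) ≠ 0) => h m hm
    refine ⟨(MvPolynomial.support (R := k) (σ := OIIndex n g.1) (E.equiv g.1 g.2)).sup u,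
      fun m hm => ⟨u m, ?_, (hu m hm).2⟩⟩
    exact Finset.le_sup (f := u) (MvPolynomial.mem_support_iff.2 hm)
  choose! W hW using hbound
  obtain ⟨B, hB⟩ := (hG.image W).bddAbove
  have hGB : ∀ g ∈ G, g.2 ∈ (I (Set.Iic B)).carrier g.1 := by
    intro g hg m hm
    obtain ⟨u, hu, h⟩ := hW g hg m hm
    exact ⟨u, (Set.mem_Iic.1 hu).trans (hB ⟨g, hg, rfl⟩), h⟩
  let w := max B (n i) + 1
  let c : A.obj w := (E.equiv w).symm (MvPolynomial.monomial (cycleExponent n i w) (1 : k))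
  have hc : E.equiv w c = MvPolynomial.monomial (cycleExponent n i w) (1 : k) :=
    (E.equiv w).apply_symm_apply _
  have hcI : c ∈ (I Set.univ).carrier w := by
    classical
    intro m hm
    rw [hc, MvPolynomial.coeff_monomial] at hm
    refine ⟨w, trivial, by lia, RelEmbedding.refl _, ?_⟩
    split_ifs at hm with h
    · rw [← h]
      exact Finsupp.mapDomain_id.le
    · exact absurd rfl hm
  obtain ⟨u, hu, hu', ε, hε⟩ := hmin (I (Set.Iic B)) hGB w hcI (cycleExponent n i w) (by
    rw [hc, MvPolynomial.coeff_monomial, if_pos rfl]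
    exact one_ne_zero)
  have := eq_of_mapDomain_cycleExponent_le (by lia) hu' ε hε
  rw [Set.mem_Iic] at hu
  lia

end Cycles

/-! ### A Gröbner basis argument for families of vector spaces with well-ordered bases -/

/-- In a well-quasi-order every set has a finite subset below all of its elements. -/
theorem WellQuasiOrdered.exists_finite_subset {α : Type*} {r : α → α → Prop}
    (h : WellQuasiOrdered r) (L : Set α) :
    ∃ S : Set α, S.Finite ∧ S ⊆ L ∧ ∀ x ∈ L, ∃ y ∈ S, r y x := by
  by_contra! hcon
  obtain ⟨f, -, hf⟩ := exists_seq_of_forall_finset_exists (fun x => x ∈ L) (fun x y => ¬ r x y)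
    fun s hs => hcon s s.finite_toSet hs
  obtain ⟨i, j, hij, hr⟩ := h f
  exact hf i j hij hr

section Groebner

variable {k : Type*} [Field k] {K : ℕ → Type*} [∀ w, LinearOrder (K w)]

/-- The leading basis element of a nonzero vector. -/
theorem Finsupp.exists_isGreatest_support {K : Type*} [LinearOrder K] {x : K →₀ k} (hx : x ≠ 0) :
    ∃ b, IsGreatest (x.support : Set K) b :=
  ⟨_, Finset.isGreatest_max' x.support (Finsupp.support_nonempty_iff.2 hx)⟩

/-- Let `T` be a set of strictly monotone maps between well-ordered bases `K w`, such that `T`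
makes the union of all bases well-quasi-ordered. Then a family of subspaces stable under `T` is
generated under `T` by finitely many of its elements, namely by elements whose leading terms
divide all other leading terms. -/
theorem exists_finite_generating_set [∀ w, WellFoundedLT (K w)]
    (T : ∀ w w', Set (K w → K w')) (hT : ∀ w w', ∀ t ∈ T w w', StrictMono t)
    (hwqo : WellQuasiOrdered fun a b : Σ w, K w => ∃ t ∈ T a.1 b.1, t a.2 = b.2)
    (N : ∀ w, Submodule k (K w →₀ k))
    (hN : ∀ w w', ∀ t ∈ T w w', ∀ x ∈ N w, x.mapDomain t ∈ N w') :
    ∃ G : Set (Σ w, K w →₀ k), G.Finite ∧ (∀ g ∈ G, g.2 ∈ N g.1) ∧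
      ∀ N' : ∀ w, Submodule k (K w →₀ k),
        (∀ w w', ∀ t ∈ T w w', ∀ x ∈ N' w, x.mapDomain t ∈ N' w') →
        (∀ g ∈ G, g.2 ∈ N' g.1) → ∀ w, N w ≤ N' w := by
  obtain ⟨S, hS, hSL, hmin⟩ := hwqo.exists_finite_subset
    {b : Σ w, K w | ∃ x ∈ N b.1, IsGreatest (x.support : Set (K b.1)) b.2}
  choose! g hg using fun b (hb : b ∈ S) => show ∃ x ∈ N b.1, _ from hSL hb
  refine ⟨(fun b => ⟨b.1, g b⟩) '' S, hS.image _, ?_, fun N' hN' hG w x hx => ?_⟩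
  · rintro _ ⟨b, hb, rfl⟩
    exact (hg b hb).1
  -- Induction on the leading basis element.
  suffices H : ∀ b : K w, ∀ x ∈ N w, (∀ c ∈ x.support, c ≤ b) → x ∈ N' w by
    by_cases h0 : x = 0
    · rw [h0]
      exact zero_mem _
    · obtain ⟨b, hb⟩ := Finsupp.exists_isGreatest_support h0
      exact H b x hx fun c hc => hb.2 hc
  intro b
  induction b using WellFoundedLT.induction with
  | _ b ih =>
    intro x hx hxb
    have hlt : ∀ y ∈ N w, (∀ c ∈ y.support, c < b) → y ∈ N' w := by
      intro y hy hyb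
      by_cases h0 : y = 0
      · rw [h0]
        exact zero_mem _
      · obtain ⟨b', hb'⟩ := Finsupp.exists_isGreatest_support h0
        exact ih b' (hyb b' hb'.1) y hy fun c hc => hb'.2 hc
    by_cases hb : b ∈ x.support
    · obtain ⟨a, ha, t, ht, hta⟩ := hmin ⟨w, b⟩ ⟨x, hx, hb, fun c hc => hxb c hc⟩
      dsimp only at ht hta
      have hga := (hg a ha).2
      set z := (g a).mapDomain t with hz
      have hzN : z ∈ N w := hN _ _ t ht _ (hg a ha).1
      have hzN' : z ∈ N' w := hN' _ _ t ht _ (hG _ ⟨a, ha, rfl⟩)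
      have hzb : z b ≠ 0 := by
        rw [hz, ← hta, Finsupp.mapDomain_apply (hT _ _ t ht).injective]
        exact Finsupp.mem_support_iff.1 hga.1
      have hzle : ∀ c, b < c → z c = 0 := by
        classical
        intro c hc
        by_contra hzc
        obtain ⟨e, he, rfl⟩ := Finset.mem_image.1
          (Finsupp.mapDomain_support (Finsupp.mem_support_iff.2 hzc))
        rw [← hta] at hc
        exact absurd (hga.2 he) (not_le.2 ((hT _ _ t ht).lt_iff_lt.1 hc))
      have hr : x - (x b / z b) • z ∈ N' w := by
        refine hlt _ (sub_mem hx (Submodule.smul_mem _ _ hzN)) fun c hc => ?_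
        rw [Finsupp.mem_support_iff] at hc
        by_contra hcb
        refine hc ?_
        rcases (not_lt.1 hcb).eq_or_lt with rfl | hbc
        · simp [hzb]
        · have : x c = 0 := by
            by_contra h
            exact absurd (hxb c (Finsupp.mem_support_iff.2 h)) (not_le.2 hbc)
          simp [this, hzle c hbc]
      rw [← sub_add_cancel x ((x b / z b) • z)]
      exact add_mem hr (Submodule.smul_mem _ _ hzN')
    · exact hlt x hx fun c hc => (hxb c hc).lt_of_ne fun h => hb (h ▸ hc)

end Groebner

/-! ### Monomial orders compatible with morphisms of `OI` -/

section Orders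

namespace OIIndex

variable {r : ℕ} {n : Fin r → ℕ}

/-- The sequence `(i, π 1 + 1, π 2 + 1, …)`, continued by zeros. -/
def key {w : ℕ} (v : OIIndex n w) : Lex (ℕ → ℕ) :=
  toLex fun p => match p with
    | 0 => v.1
    | p + 1 => if h : p < n v.1 then v.2 ⟨p, h⟩ + 1 else 0

theorem key_succ {w : ℕ} (i : Fin r) (π : OIHom (n i) w) (p : ℕ) :
    ofLex (key ⟨i, π⟩) (p + 1) = if h : p < n i then (π ⟨p, h⟩ : ℕ) + 1 else 0 := rfl

theorem key_injective (w : ℕ) : Function.Injective (key : OIIndex n w → _) := by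
  rintro ⟨i, π⟩ ⟨j, δ⟩ h
  obtain rfl : i = j := Fin.ext (congrFun (congrArg ofLex h) 0)
  refine Sigma.ext rfl (heq_of_eq (RelEmbedding.ext fun a => Fin.ext ?_))
  have := congrFun (congrArg ofLex h) (a + 1)
  rw [key_succ, key_succ, dif_pos a.2, dif_pos a.2] at this
  exact Nat.succ_injective this

theorem key_push_lt_key_push {w w' : ℕ} (ε : OIHom w w') {v v' : OIIndex n w}
    (h : v.key < v'.key) : (push ε v).key < (push ε v').key := by
  obtain ⟨i, π⟩ := v
  obtain ⟨j, δ⟩ := v'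
  obtain ⟨p, heq, hlt⟩ : ∃ p, (∀ q < p, ofLex (key ⟨i, π⟩) q = ofLex (key ⟨j, δ⟩) q) ∧
    ofLex (key ⟨i, π⟩) p < ofLex (key ⟨j, δ⟩) p := h
  refine (show ∃ p, (∀ q < p, ofLex (key ⟨i, π.trans ε⟩) q = ofLex (key ⟨j, δ.trans ε⟩) q) ∧
    ofLex (key ⟨i, π.trans ε⟩) p < ofLex (key ⟨j, δ.trans ε⟩) p from ?_)
  cases p with
  | zero => exact ⟨0, fun q hq => absurd hq (Nat.not_lt_zero q), hlt⟩
  | succ p =>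
    obtain rfl : i = j := Fin.ext (heq 0 (Nat.succ_pos p))
    refine ⟨p + 1, fun q hq => ?_, ?_⟩
    · cases q with
      | zero => rfl
      | succ q =>
        have := heq (q + 1) hq
        rw [key_succ, key_succ] at this ⊢
        by_cases hqn : q < n i
        · rw [dif_pos hqn, dif_pos hqn] at this ⊢
          rw [RelEmbedding.trans_apply, RelEmbedding.trans_apply,
            Fin.ext (Nat.succ_injective this)]
        · rw [dif_neg hqn, dif_neg hqn]
    · rw [key_succ, key_succ] at hlt ⊢
      by_cases hpn : p < n i
      · rw [dif_pos hpn, dif_pos hpn] at hlt ⊢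
        exact Nat.succ_lt_succ (ε.strictMono (Fin.lt_def.2 (Nat.lt_of_succ_lt_succ hlt)))
      · rw [dif_neg hpn, dif_neg hpn] at hlt
        exact absurd hlt (lt_irrefl 0)

end OIIndex

/-- The standard basis `OIIndex n w`, carrying the lexicographic order of the sequences
`(i, π 1, π 2, …)`. -/
def OrderedIndex {r : ℕ} (n : Fin r → ℕ) (w : ℕ) : Type := OIIndex n w

namespace OrderedIndex

variable {r : ℕ} {n : Fin r → ℕ}

instance (w : ℕ) : Finite (OrderedIndex n w) := inferInstanceAs (Finite (OIIndex n w))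

noncomputable instance (w : ℕ) : LinearOrder (OrderedIndex n w) :=
  LinearOrder.lift' OIIndex.key (OIIndex.key_injective w)

/-- The action of a morphism of `OI`. -/
def push {w w' : ℕ} (ε : OIHom w w') : OrderedIndex n w → OrderedIndex n w' := OIIndex.push ε

theorem push_strictMono {w w' : ℕ} (ε : OIHom w w') :
    StrictMono (push ε : OrderedIndex n w → OrderedIndex n w') :=
  fun _ _ h => OIIndex.key_push_lt_key_push ε h

end OrderedIndex

/-- Renaming the variables of monomials along a strictly monotone map preserves the lexicographic
order. -/
theorem Finsupp.Lex.mapDomain_strictMono {α β : Type*} [LinearOrder α] [LinearOrder β]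
    {f : α → β} (hf : StrictMono f) :
    StrictMono fun m : Lex (α →₀ ℕ) => toLex ((ofLex m).mapDomain f) := by
  intro a b hab
  obtain ⟨i, heq, hlt⟩ := Finsupp.Lex.lt_iff.1 hab
  refine Finsupp.Lex.lt_iff.2 ⟨f i, fun j hj => ?_, ?_⟩
  · by_cases h : j ∈ Set.range f
    · obtain ⟨j, rfl⟩ := h
      exact (Finsupp.mapDomain_apply hf.injective _ _).trans
        ((heq j (hf.lt_iff_lt.1 hj)).trans (Finsupp.mapDomain_apply hf.injective _ _).symm)
    · exact (Finsupp.mapDomain_of_notMem_range _ _ h).trans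
        (Finsupp.mapDomain_of_notMem_range _ _ h).symm
  · exact lt_of_eq_of_lt (Finsupp.mapDomain_apply hf.injective _ _)
      (lt_of_lt_of_eq hlt (Finsupp.mapDomain_apply hf.injective _ _).symm)

/-- The monomials of a free module over a polynomial algebra: a basis element (for generators of
the given widths) times a monomial. -/
abbrev ModuleMonomial {s r : ℕ} (width : Fin s → ℕ) (n : Fin r → ℕ) (w : ℕ) : Type :=
  OrderedIndex width w ×ₗ Lex (OrderedIndex n w →₀ ℕ)

/-- The operation of applying `ε` and multiplying by the monomial with exponent `a`. -/
noncomputable def ModuleMonomial.act {s r : ℕ} {width : Fin s → ℕ} {n : Fin r → ℕ} {w w' : ℕ}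
    (ε : OIHom w w') (a : OrderedIndex n w' →₀ ℕ) (b : ModuleMonomial width n w) :
    ModuleMonomial width n w' :=
  toLex ((ofLex b).1.push ε,
    toLex a + toLex ((ofLex (ofLex b).2).mapDomain (OrderedIndex.push ε)))

theorem ModuleMonomial.act_strictMono {s r : ℕ} {width : Fin s → ℕ} {n : Fin r → ℕ} {w w' : ℕ}
    (ε : OIHom w w') (a : OrderedIndex n w' →₀ ℕ) :
    StrictMono (ModuleMonomial.act ε a : ModuleMonomial width n w → _) := by
  intro b c hbc
  rcases Prod.Lex.lt_iff.1 hbc with h | ⟨h1, h2⟩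
  · exact Prod.Lex.lt_iff.2 (Or.inl (OrderedIndex.push_strictMono ε h))
  · refine Prod.Lex.lt_iff.2 (Or.inr ⟨congrArg (OrderedIndex.push ε) h1, ?_⟩)
    exact add_lt_add_right (Finsupp.Lex.mapDomain_strictMono (OrderedIndex.push_strictMono ε) h2) _

end Orders

/-! ### Well-quasi-orders from Higman's lemma -/

section Higman

theorem List.SublistForall₂.exists_orderEmbedding {L : Type*} {R : L → L → Prop} {l₁ l₂ : List L}
    (h : List.SublistForall₂ R l₁ l₂) :
    ∃ f : Fin l₁.length ↪o Fin l₂.length, ∀ p, R (l₁.get p) (l₂.get (f p)) := by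
  obtain ⟨l, hl, hsub⟩ := List.sublistForall₂_iff.1 h
  obtain ⟨f, hf⟩ := List.sublist_iff_exists_fin_orderEmbedding_get_eq.1 hsub
  refine ⟨(Fin.castOrderIso hl.length_eq).toOrderEmbedding.trans f, fun p => ?_⟩
  have := hl.get p.2 (by rw [← hl.length_eq]; exact p.2)
  have h2 := hf (Fin.cast hl.length_eq p)
  rw [RelEmbedding.trans_apply]
  exact h2 ▸ this

/-- Higman's lemma for words given as functions on `Fin w`. -/
theorem wellQuasiOrdered_words (L : Type*) [Preorder L] [WellQuasiOrderedLE L] :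
    WellQuasiOrdered fun a b : Σ w, Fin w → L => ∃ ε : OIHom a.1 b.1, ∀ p, a.2 p ≤ b.2 (ε p) := by
  intro f
  obtain ⟨i, j, hij, h⟩ := (Set.PartiallyWellOrderedOn.partiallyWellOrderedOn_sublistForall₂
    (s := (Set.univ : Set L)) (· ≤ ·)
    (Set.partiallyWellOrderedOn_univ_iff.2 wellQuasiOrdered_le)).exists_lt
    (f := fun i => List.ofFn (f i).2) (fun _ _ _ => Set.mem_univ _)
  obtain ⟨g, hg⟩ := h.exists_orderEmbedding
  have hi := List.length_ofFn (f := (f i).2)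
  have hj := List.length_ofFn (f := (f j).2)
  refine ⟨i, j, hij, ((Fin.castOrderIso hi.symm).toOrderEmbedding.trans g).trans
    (Fin.castOrderIso hj).toOrderEmbedding, fun p => ?_⟩
  have := hg (Fin.cast hi.symm p)
  rw [List.get_ofFn, List.get_ofFn] at this
  exact this

theorem OIHom.trans_eq_of_range_subset {u w w' : ℕ} (π : OIHom u w) (π' : OIHom u w')
    (ε : OIHom w w') (h : ∀ p ∈ Set.range π, ε p ∈ Set.range π') :
    (π.trans ε : OIHom u w') = π' := by
  classical
  have hsub : Set.range (π.trans ε : OIHom u w') ⊆ Set.range π' := by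
    rintro _ ⟨a, rfl⟩
    exact h _ ⟨a, rfl⟩
  have hcard : ∀ δ : OIHom u w', (Set.range δ).ncard = u := fun δ => by
    rw [← Set.image_univ, Set.ncard_image_of_injective _ δ.injective, Set.ncard_univ,
      Nat.card_eq_fintype_card, Fintype.card_fin]
  have heq := Set.eq_of_subset_of_ncard_le hsub (by rw [hcard, hcard])
  exact DFunLike.coe_injective
    (((OrderEmbedding.strictMono (π.trans ε : OIHom u w')).range_inj π'.strictMono).1 heq)

/-- The morphism out of `[0]`. -/
def OIHom.ofWidthZero {n : ℕ} (h : n = 0) (w : ℕ) : OIHom n w :=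
  OrderEmbedding.ofStrictMono (fun a => absurd a.2 (by lia)) (fun a => absurd a.2 (by lia))

/-- The morphism out of `[1]` with image `{p}`. -/
def OIHom.ofWidthOne {n : ℕ} (h : n = 1) {w : ℕ} (p : Fin w) : OIHom n w :=
  OrderEmbedding.ofStrictMono (fun _ => p) (fun a b hab => by
    have := a.2
    have := b.2
    rw [Fin.lt_def] at hab
    lia)

/-- If all generators of the algebra have width at most one, the monomials of a free module are
well-quasi-ordered by divisibility up to `OI`-morphisms. A monomial `m e_π` of width `w` is encoded
as a word of length `w`, whose letter at `p` records whether `p` lies in the image of `π` and the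
exponents of the width one variables at `p`; the exponents of the finitely many width zero
variables and the index of the basis element are recorded separately. -/
theorem wellQuasiOrdered_exponents {s r : ℕ} (width : Fin s → ℕ) (n : Fin r → ℕ)
    (hn : ∀ i, n i ≤ 1) :
    WellQuasiOrdered fun a b : Σ w, OIIndex width w × (OIIndex n w →₀ ℕ) =>
      ∃ ε : OIHom a.1 b.1, a.2.1.push ε = b.2.1 ∧
        a.2.2.mapDomain (OIIndex.push ε) ≤ b.2.2 := by
  classical
  let glob (a : Σ w, OIIndex width w × (OIIndex n w →₀ ℕ)) : (ℕ × ℕ) × (Fin r → ℕ) :=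
    ((a.2.1.1, s - a.2.1.1), fun i =>
      if h : n i = 0 then a.2.2 ⟨i, OIHom.ofWidthZero h a.1⟩ else 0)
  let word (a : Σ w, OIIndex width w × (OIIndex n w →₀ ℕ)) : Σ w, Fin w → ℕ × (Fin r → ℕ) :=
    ⟨a.1, fun p => (if p ∈ Set.range a.2.1.2 then 1 else 0, fun i =>
      if h : n i = 1 then a.2.2 ⟨i, OIHom.ofWidthOne h p⟩ else 0)⟩
  intro f
  obtain ⟨x, y, hxy, hglob, ε, hword⟩ :=
    (wellQuasiOrdered_le (α := (ℕ × ℕ) × (Fin r → ℕ))).prod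
      (wellQuasiOrdered_words (ℕ × (Fin r → ℕ))) fun x => (glob (f x), word (f x))
  refine ⟨x, y, hxy, ?_⟩
  generalize f x = a at *
  generalize f y = b at *
  obtain ⟨w, ⟨i, π⟩, m⟩ := a
  obtain ⟨w', ⟨j, π'⟩, m'⟩ := b
  refine ⟨ε, ?_, fun v' => ?_⟩
  · obtain rfl : i = j := by
      have h1 : (i : ℕ) ≤ j := hglob.1.1
      have h2 : s - (i : ℕ) ≤ s - j := hglob.1.2
      exact Fin.ext (by lia)
    refine Sigma.ext rfl (heq_of_eq (OIHom.trans_eq_of_range_subset π π' ε fun p hp => ?_))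
    have h : (if p ∈ Set.range π then 1 else 0) ≤ if ε p ∈ Set.range π' then 1 else 0 :=
      (hword p).1
    by_contra hcon
    rw [if_pos hp, if_neg hcon] at h
    exact absurd h (by norm_num)
  · dsimp only
    by_cases hv : v' ∈ Set.range (OIIndex.push ε)
    · obtain ⟨⟨l, δ⟩, rfl⟩ := hv
      rw [Finsupp.mapDomain_apply (OIIndex.push_injective ε)]
      change m ⟨l, δ⟩ ≤ m' ⟨l, δ.trans ε⟩
      rcases Nat.le_one_iff_eq_zero_or_eq_one.1 (hn l) with hl | hl
      · have h : (if h : n l = 0 then m ⟨l, OIHom.ofWidthZero h w⟩ else 0) ≤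
          if h : n l = 0 then m' ⟨l, OIHom.ofWidthZero h w'⟩ else 0 := hglob.2 l
        rw [dif_pos hl, dif_pos hl] at h
        rwa [show δ = OIHom.ofWidthZero hl w from RelEmbedding.ext fun a => absurd a.2 (by lia),
          show RelEmbedding.trans (OIHom.ofWidthZero hl w) ε = OIHom.ofWidthZero hl w' from
            RelEmbedding.ext fun a => absurd a.2 (by lia)]
      · let p := δ ⟨0, by lia⟩
        have h : (if h : n l = 1 then m ⟨l, OIHom.ofWidthOne h p⟩ else 0) ≤
          if h : n l = 1 then m' ⟨l, OIHom.ofWidthOne h (ε p)⟩ else 0 := (hword p).2 l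
        rw [dif_pos hl, dif_pos hl] at h
        have hδ : δ = OIHom.ofWidthOne hl p := RelEmbedding.ext fun a =>
          congrArg δ (Fin.ext (by have := a.2; dsimp only; lia))
        rw [hδ]
        exact h
    · rw [Finsupp.mapDomain_of_notMem_range _ _ hv]
      exact Nat.zero_le _

end Higman

/-! ### Free modules over noetherian polynomial algebras are noetherian -/

section Noetherian

variable {k : Type u} [Field k] {A : GradedOIAlgebra k} {r : ℕ} {n : Fin r → ℕ} {deg : Fin r → ℤ}

/-- The isomorphism of `A(w)` with a polynomial ring. -/
def GradedOIAlgebra.Iso.polyEquiv (E : A.Iso (symOIAlgebra k n deg)) (w : ℕ) :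
    A.obj w ≃ₐ[k] MvPolynomial (OIIndex n w) k :=
  E.equiv w

theorem GradedOIAlgebra.Iso.map_polyEquiv_symm (E : A.Iso (symOIAlgebra k n deg)) {w w' : ℕ}
    (ε : OIHom w w') (q : MvPolynomial (OIIndex n w) k) :
    A.map ε ((E.polyEquiv w).symm q)
      = (E.polyEquiv w').symm (MvPolynomial.rename (OIIndex.push ε) q) := by
  rw [AlgEquiv.eq_symm_apply]
  refine (E.naturality ε _).trans ?_
  exact congrArg (MvPolynomial.rename (OIIndex.push ε)) ((E.polyEquiv w).apply_symm_apply q)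

namespace GradedOIModule.HomogeneousBasis

variable {F : GradedOIModule A}

/-- The multiple by a monomial with coefficient `c` of a basis element of `F(w)`. -/
noncomputable def term (f : F.HomogeneousBasis) (E : A.Iso (symOIAlgebra k n deg)) {w : ℕ}
    (v : OIIndex f.width w) (m : OIIndex n w →₀ ℕ) : k →+ F.obj w where
  toFun c := (E.polyEquiv w).symm (MvPolynomial.monomial m c) • f.basisAt w v
  map_zero' := by simp
  map_add' c d := by rw [map_add, map_add, add_smul]

theorem term_apply (f : F.HomogeneousBasis) (E : A.Iso (symOIAlgebra k n deg)) {w : ℕ}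
    (v : OIIndex f.width w) (m : OIIndex n w →₀ ℕ) (c : k) :
    f.term E v m c = (E.polyEquiv w).symm (MvPolynomial.monomial m c) • f.basisAt w v := rfl

theorem term_mul (f : F.HomogeneousBasis) (E : A.Iso (symOIAlgebra k n deg)) {w : ℕ}
    (v : OIIndex f.width w) (m : OIIndex n w →₀ ℕ) (c d : k) :
    f.term E v m (c * d) = algebraMap k (A.obj w) c • f.term E v m d := by
  rw [term_apply, term_apply, smul_smul, ← Algebra.smul_def, ← map_smul (E.polyEquiv w).symm c,
    MvPolynomial.smul_monomial, smul_eq_mul]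

theorem term_push (f : F.HomogeneousBasis) (E : A.Iso (symOIAlgebra k n deg)) {w w' : ℕ}
    (ε : OIHom w w') (a : OIIndex n w' →₀ ℕ) (v : OIIndex f.width w) (m : OIIndex n w →₀ ℕ)
    (c : k) :
    f.term E (v.push ε) (a + m.mapDomain (OIIndex.push ε)) c =
      (E.polyEquiv w').symm (MvPolynomial.monomial a 1) • F.map ε (f.term E v m c) := by
  have hbasis : F.map ε (f.basisAt w v) = f.basisAt w' (v.push ε) := by
    rw [f.basisAt_apply, f.basisAt_apply, ← F.map_comp]
    rfl
  rw [term_apply, term_apply, F.map_smul, hbasis, smul_smul, E.map_polyEquiv_symm, ← map_mul,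
    MvPolynomial.rename_monomial, MvPolynomial.monomial_mul, one_mul]

/-- The additive map sending formal `k`-linear combinations of module monomials to the element of
`F(w)` they represent. -/
noncomputable def realize (f : F.HomogeneousBasis) (E : A.Iso (symOIAlgebra k n deg)) (w : ℕ) :
    (ModuleMonomial f.width n w →₀ k) →+ F.obj w :=
  Finsupp.liftAddHom fun b => f.term E (ofLex b).1 (ofLex (ofLex b).2)

theorem realize_single (f : F.HomogeneousBasis) (E : A.Iso (symOIAlgebra k n deg)) (w : ℕ)
    (b : ModuleMonomial f.width n w) (c : k) :
    f.realize E w (Finsupp.single b c) = f.term E (ofLex b).1 (ofLex (ofLex b).2) c :=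
  Finsupp.liftAddHom_apply_single _ _ _

theorem realize_smul (f : F.HomogeneousBasis) (E : A.Iso (symOIAlgebra k n deg)) (w : ℕ)
    (c : k) (x : ModuleMonomial f.width n w →₀ k) :
    f.realize E w (c • x) = algebraMap k (A.obj w) c • f.realize E w x := by
  induction x using Finsupp.induction_linear with
  | zero => simp
  | add x y hx hy => simp only [smul_add, map_add, hx, hy]
  | single b d =>
    rw [Finsupp.smul_single, realize_single, realize_single]
    exact f.term_mul E _ _ c d

theorem realize_mapDomain (f : F.HomogeneousBasis) (E : A.Iso (symOIAlgebra k n deg)) {w w' : ℕ}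
    (ε : OIHom w w') (a : OrderedIndex n w' →₀ ℕ) (x : ModuleMonomial f.width n w →₀ k) :
    f.realize E w' (x.mapDomain (ModuleMonomial.act ε a)) =
      (E.polyEquiv w').symm (MvPolynomial.monomial (σ := OIIndex n w') a 1) •
        F.map ε (f.realize E w x) := by
  induction x using Finsupp.induction_linear with
  | zero => simp
  | add x y hx hy => simp only [Finsupp.mapDomain_add, smul_add, map_add, hx, hy]
  | single b d =>
    rw [Finsupp.mapDomain_single, realize_single, realize_single]
    exact f.term_push E ε a _ _ d

theorem realize_surjective (f : F.HomogeneousBasis) (E : A.Iso (symOIAlgebra k n deg)) (w : ℕ) :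
    Function.Surjective (f.realize E w) := by
  intro y
  rw [← AddMonoidHom.mem_range]
  obtain ⟨c, rfl⟩ := (f.basisAt w).repr.symm.surjective y
  induction c using Finsupp.induction_linear with
  | zero => rw [map_zero]; exact zero_mem _
  | add x y hx hy => rw [map_add]; exact add_mem hx hy
  | single v a =>
    obtain ⟨q, rfl⟩ := (E.polyEquiv w).symm.surjective a
    rw [Module.Basis.repr_symm_single]
    induction q using MvPolynomial.induction_on' with
    | monomial m c =>
      exact ⟨_, f.realize_single E w (toLex (v, toLex m)) c⟩
    | add p q hp hq => rw [map_add, add_smul]; exact add_mem hp hq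

/-- Finitely generated graded free modules over a polynomial algebra with generators of width at
most one are noetherian. -/
theorem fg_of_width_le_one (f : F.HomogeneousBasis) (E : A.Iso (symOIAlgebra k n deg))
    (hn : ∀ i, n i ≤ 1) (N : OISubmodule F.toOIModule) : N.FG := by
  let T (w w' : ℕ) : Set (ModuleMonomial f.width n w → ModuleMonomial f.width n w') :=
    {t | ∃ ε a, t = ModuleMonomial.act ε a}
  -- Submodules of `F`, seen as families of spaces of linear combinations of module monomials.
  let pull (N : OISubmodule F.toOIModule) (w : ℕ) : Submodule k (ModuleMonomial f.width n w →₀ k) :=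
    { carrier := {x | f.realize E w x ∈ N.carrier w}
      add_mem' := fun {x y} hx hy => by
        rw [Set.mem_ofPred_eq, map_add]
        exact add_mem hx hy
      zero_mem' := by
        rw [Set.mem_ofPred_eq, map_zero]
        exact zero_mem _
      smul_mem' := fun c x hx => by
        rw [Set.mem_ofPred_eq, realize_smul]
        exact Submodule.smul_mem _ _ hx }
  have hpull : ∀ N w w', ∀ t ∈ T w w', ∀ x ∈ pull N w, x.mapDomain t ∈ pull N w' := by
    rintro N w w' _ ⟨ε, a, rfl⟩ x hx
    change f.realize E w' _ ∈ N.carrier w'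
    exact (f.realize_mapDomain E ε a x).symm ▸ Submodule.smul_mem _ _ (N.map_mem ε _ hx)
  have hwqo : WellQuasiOrdered fun a b : Σ w, ModuleMonomial f.width n w =>
      ∃ t ∈ T a.1 b.1, t a.2 = b.2 := by
    intro x
    obtain ⟨i, j, hij, ε, h1, h2⟩ := wellQuasiOrdered_exponents f.width n hn
      fun i => ⟨(x i).1, (ofLex (x i).2).1, ofLex (ofLex (x i).2).2⟩
    obtain ⟨a, ha⟩ := le_iff_exists_add'.1 h2
    exact ⟨i, j, hij, _, ⟨ε, a, rfl⟩, Prod.ext h1 ha.symm⟩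
  obtain ⟨G, hG, hGN, hmin⟩ := exists_finite_generating_set (k := k) T
    (by rintro w w' _ ⟨ε, a, rfl⟩; exact ModuleMonomial.act_strictMono ε a) hwqo (pull N) (hpull N)
  refine ⟨(fun g => ⟨g.1, f.realize E g.1 g.2⟩) '' G, hG.image _, ?_, fun N' hN' w y hy => ?_⟩
  · rintro _ ⟨g, hg, rfl⟩
    exact hGN g hg
  · obtain ⟨x, rfl⟩ := f.realize_surjective E w y
    exact hmin (pull N') (hpull N') (fun g hg => hN' _ ⟨g, hg, rfl⟩) w hy

end GradedOIModule.HomogeneousBasis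

end Noetherian

theorem mainTheorem1 {k : Type u} [Field k] (A : GradedOIAlgebra k) (hA : A.IsPolynomial)
    (M : GradedOIModule A) (hM : M.FG) :
    (∀ F : FreeOIResolution M, ∃ P : FreeOIResolution M, P.IsMinimal ∧ P.IsDirectSummand F) ∧
    (∀ P Q : FreeOIResolution M, P.IsMinimal → Q.IsMinimal → P.IsIsomorphic Q) ∧
    (A.IsNoetherian → ∃ P : FreeOIResolution M, P.IsMinimal) := by
  have hconn := hA.isConnected
  refine ⟨fun F => ⟨F.minimalPart hconn, F.isMinimal_minimalPart hconn,
    F.minimalPart_isDirectSummand hconn⟩, fun P Q hP hQ => hP.isIsomorphic hconn hQ, fun hN => ?_⟩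
  obtain ⟨r, n, deg, -, ⟨E⟩⟩ := hA
  obtain ⟨F⟩ := FreeOIResolution.nonempty_of_fg_ker hM fun F U φ ⟨f⟩ =>
    f.fg_of_width_le_one E (width_le_one_of_isNoetherian E hN) φ.ker
  exact ⟨F.minimalPart hconn, F.isMinimal_minimalPart hconn⟩
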